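/- For $x\in\mathbb R$ and $\delta>0$ let $$q_{\min}(x,\delta)=\min\left\{q\in\mathbb N:\ \exists\, p\in\mathbb Z,\ \tfrac pq\in\left(x-\tfrac\delta2,x+\tfrac\delta2\right)\right\},\qquad \mathbb N=\{1,2,3,\dots\}.$$ For real $Q\ge1$ let $\mathcal F_Q=\{\frac pq\in[0,1):\ p,q\in\mathbb Z,\ \gcd(p,q)=1,\ 0<q\le Q\}$ be the set of Farey fractions of level $Q$, and let $\sigma_Q=\frac{3}{\pi^2}Q^2$. The gap at $r\in\mathcal F_Q$ is $r'-r$, where $r'$ is the smallest element of $\mathcal F_Q\cup\{1\}$ larger than $r$. Let $$H(s)=\lim_{Q\to\infty}\frac{\#\{r\in\mathcal F_Q:\ \text{the gap at } r \text{ is larger than } s\sigma_Q^{-1}\}}{\#\mathcal F_Q}\qquad(s\ge0)$$ be the Hall distribution, and put $\eta(s)=\frac{6}{\pi^2}\,s\,H\!\left(\frac{3}{\pi^2}s^2\right)$ for $s\ge0$. Proposition. The limit defining $H(s)$ exists for every $s\ge0$, and $\eta$ is a probability density on $[0,\infty)$. For every interval $\mathcal D\subset[0,1]$ and every $L>0$,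 $$\lim_{\delta\to0^+}\operatorname{vol}\left\{x\in\mathcal D:\ \delta^{1/2}q_{\min}(x,\delta)>L\right\}=\operatorname{vol}\mathcal D\int_L^\infty\eta(s)\,ds,$$ where $\operatorname{vol}$ denotes Lebesgue measure. Moreover, $$\eta(s)=\frac{6}{\pi^2}\times\begin{cases}s&\text{if } 0\le s\le1,\\[2pt] -s+2s^{-1}+4s^{-1}\log s&\text{if } 1\le s\le2,\\[2pt] -s+2s^{-1}+2s\sqrt{\frac14-s^{-2}}-4s^{-1}\log\left(\frac12+\sqrt{\frac14-s^{-2}}\right)&\text{if } s\ge2.\end{cases}$$ -/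

import Mathlib

open Filter Topology MeasureTheory Set

noncomputable section

/-- The smallest denominator of all fractions in the open interval of length `δ` centred at `x`.
For `δ > 0` the set below is non-empty, so that the infimum is attained. -/
def qMin (x δ : ℝ) : ℕ :=
  sInf {q : ℕ | 0 < q ∧ ∃ p : ℤ, (p : ℝ) / (q : ℝ) ∈ Ioo (x - δ / 2) (x + δ / 2)}

/-- The Farey fractions of level `Q` in `[0, 1)`. -/
def fareySet (Q : ℝ) : Set ℝ :=
  {r : ℝ | r ∈ Ico (0 : ℝ) 1 ∧
    ∃ p q : ℤ, IsCoprime p q ∧ 0 < q ∧ (q : ℝ) ≤ Q ∧ r = (p : ℝ) / (q : ℝ)}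

/-- The asymptotic number `σ_Q = 3 Q² / π²` of Farey fractions of level `Q`. -/
def fareySigma (Q : ℝ) : ℝ := 3 / Real.pi ^ 2 * Q ^ 2

/-- The Farey fraction of level `Q` following `r`, where the fraction following the largest element
of the Farey set is `1` (which is `0` modulo `1`). -/
def fareyNext (Q r : ℝ) : ℝ := sInf {r' : ℝ | r < r' ∧ (r' ∈ fareySet Q ∨ r' = 1)}

/-- The relative frequency of gaps between consecutive Farey fractions of level `Q` (modulo `1`)
that are larger than `s / σ_Q`. -/
def fareyGapFreq (Q s : ℝ) : ℝ :=
  ({r : ℝ | r ∈ fareySet Q ∧ s / fareySigma Q < fareyNext Q r - r}.ncard : ℝ) /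
    ((fareySet Q).ncard : ℝ)

/-- The Hall distribution: the limit, as `Q → ∞`, of the relative frequency of gaps between Farey
fractions of level `Q` that are larger than `s / σ_Q`. -/
def hallH (s : ℝ) : ℝ := limUnder atTop (fun Q : ℝ => fareyGapFreq Q s)

/-- The limit density, for `s ≥ 0`. -/
def etaDensity (s : ℝ) : ℝ := 6 / Real.pi ^ 2 * s * hallH (3 / Real.pi ^ 2 * s ^ 2)

end

/-!
# The smallest denominator in a short interval and the Hall distribution

Put `Q = L / √δ`, so that `δ = L² / Q²`. The inequality `√δ * qMin x δ > L` says that no fraction of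
denominator at most `Q` is within `δ / 2` of `x`; for `x` in the gap between neighbouring Farey
fractions of level `Q` this means that `x` has distance at least `δ / 2` from both ends of the gap
(`lt_qMin_iff_of_mem_gap`). Up to `O(1 / Q)`, the volume in question is therefore the sum of
`max (gap - δ) 0` over the gaps with left end in `D`, and by the layer cake formula it is an
integral over `t > L` of the number of gaps longer than `t² / Q²` (`sum_max_fareyGap_sub`).

The gap between neighbours `p / q < p' / n` has length `1 / (q n)`, and `(q, n)` runs through the
coprime pairs with `q, n ≤ Q < q + n`, where `p ≡ -n⁻¹` modulo `q`. Hence both the Hall distribution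
and the limit law follow from one counting theorem, `tendsto_fareyCount`: the number of pairs with
`p / q ∈ [a, b)` and `s q n < Q²` is asymptotic to `6 / π² * (b - a) * hallArea s * Q²`, where
`hallArea s` is the area of the part of the triangle `x, y ≤ 1 < x + y` where `s x y < 1`. The bound
`fareyCount_le` allows dominated convergence in the integral over `t`.

For fixed `q`, the pairs `(n, p)` are governed by the points `(u / q, u⁻¹ / q)` for units `u` modulo
`q`. These become equidistributed on the torus as `q → ∞` (`unitEquidistributed`) because Kloosterman
sums with fixed frequencies are `o(q)`. This needs no deep bound: the fourth moment of Kloosterman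
sums is controlled by counting solutions of `a + b = c + d`, `a⁻¹ + b⁻¹ = c⁻¹ + d⁻¹`
(`card_kloosterman_quadruples_le`), and `K(h, k) = K(h u, k u⁻¹)` repeats every value often enough to
give `‖K‖⁴ ≪ q³ d(q)³`, where `d(q)⁴ ≪ q`. The remaining sum over `q` has weights `φ(q) / q`; Möbius
inversion turns it into a series of Riemann sums (`tendsto_sum_totient_div`), which produces the
factor `6 / π² = ∑ μ(d) / d²`.

That the density has mass `1` follows from the limit law itself: the volume of the exceptional set is
at most `L²`. The explicit formula is a computation of `hallArea`, where the quadratic polynomial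
`t² - t + s⁻¹` has real roots precisely for `s ≥ 4`.
-/

/-! ### A divisor bound -/

theorem succ_pow_four_le_two_pow (a : ℕ) : (a + 1) ^ 4 ≤ 41 * 2 ^ a := by
  by_cases h : a < 7
  · interval_cases a <;> norm_num
  · induction a, (not_lt.1 h) using Nat.le_induction with
    | base => norm_num
    | succ n hn ih =>
      have ih := ih (by omega)
      have h1 : (n + 1 + 1) ^ 4 ≤ 2 * (n + 1) ^ 4 := by
        obtain ⟨m, rfl⟩ := Nat.exists_eq_add_of_le hn
        ring_nf
        nlinarith [sq_nonneg m, Nat.zero_le (m ^ 3), Nat.zero_le (m ^ 4)]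
      rw [pow_succ 2]
      linarith

/-- The divisor function satisfies `d(n)⁴ ≪ n`: since `(a + 1)⁴ ≤ 16 ^ a`, only the primes below `16`
cost a constant factor. -/
theorem card_divisors_pow_four_le {n : ℕ} (hn : n ≠ 0) :
    n.divisors.card ^ 4 ≤ 41 ^ 16 * n := by
  rw [Nat.card_divisors hn, ← Finset.prod_pow]
  have h1 : ∀ p ∈ n.primeFactors, (n.factorization p + 1) ^ 4 ≤
      (if p < 16 then 41 else 1) * p ^ n.factorization p := by
    intro p hp
    have hp2 := (Nat.prime_of_mem_primeFactors hp).two_le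
    split_ifs with h
    · exact (succ_pow_four_le_two_pow _).trans
        (Nat.mul_le_mul_left _ (Nat.pow_le_pow_left hp2 _))
    · rw [one_mul]
      calc (n.factorization p + 1) ^ 4 ≤ (2 ^ n.factorization p) ^ 4 :=
            Nat.pow_le_pow_left (Nat.lt_two_pow_self) _
        _ = 16 ^ n.factorization p := by rw [← pow_mul, mul_comm, pow_mul]; norm_num
        _ ≤ _ := Nat.pow_le_pow_left (not_lt.1 h) _
  refine (Finset.prod_le_prod' h1).trans ?_
  rw [Finset.prod_mul_distrib]
  refine Nat.mul_le_mul ?_ (Nat.prod_factorization_pow_eq_self hn).le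
  rw [Finset.prod_ite, Finset.prod_const_one, mul_one, Finset.prod_const]
  refine Nat.pow_le_pow_right (by norm_num) ?_
  calc (n.primeFactors.filter (· < 16)).card ≤ (Finset.range 16).card :=
        Finset.card_le_card (fun p hp => by simpa using (Finset.mem_filter.1 hp).2)
    _ = 16 := by simp

theorem le_totient_mul_card_divisors (n : ℕ) : n ≤ n.totient * n.divisors.card := by
  rcases Nat.eq_zero_or_pos n with rfl | hn
  · simp
  calc n = ∑ d ∈ n.divisors, d.totient := (Nat.sum_totient n).symm
    _ ≤ ∑ d ∈ n.divisors, n.totient := Finset.sum_le_sum fun d hd =>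
        Nat.le_of_dvd (Nat.totient_pos.2 hn) (Nat.totient_dvd_of_dvd (Nat.dvd_of_mem_divisors hd))
    _ = _ := by rw [Finset.sum_const, smul_eq_mul, mul_comm]

/-! ### Kloosterman sums -/

/-- The Kloosterman sum `∑ e((h u + k u⁻¹) / q)` over the units `u` modulo `q`. -/
noncomputable def kloosterman (q : ℕ) [NeZero q] (h k : ZMod q) : ℂ :=
  ∑ u : (ZMod q)ˣ, ZMod.stdAddChar (h * (u : ZMod q) + k * ((u⁻¹ : (ZMod q)ˣ) : ZMod q))

section Kloosterman

variable (q : ℕ) [NeZero q]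

/-- Invariance under the substitution `u ↦ v u`. -/
theorem kloosterman_smul (h k : ZMod q) (v : (ZMod q)ˣ) :
    kloosterman q (h * v) (k * ((v⁻¹ : (ZMod q)ˣ) : ZMod q)) = kloosterman q h k := by
  unfold kloosterman
  refine Fintype.sum_equiv (Equiv.mulLeft v) _ _ fun u => ?_
  simp only [Equiv.coe_mulLeft, Units.val_mul, mul_inv_rev, mul_assoc]
  rw [mul_comm (((v⁻¹ : (ZMod q)ˣ) : ZMod q))]

theorem card_natCast_mul_eq_zero_le (m : ℕ) :
    (Finset.univ.filter fun x : ZMod q => (m : ZMod q) * x = 0).card ≤ m.gcd q := by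
  have hg : 0 < m.gcd q := Nat.gcd_pos_of_pos_right _ (NeZero.pos q)
  refine le_trans (Finset.card_le_card fun x hx => ?_)
    (IsAddCyclic.card_nsmul_eq_zero_le (α := ZMod q) hg)
  simp only [Finset.mem_filter, Finset.mem_univ, true_and] at hx ⊢
  exact gcd_nsmul_eq_zero.2 ⟨by rwa [nsmul_eq_mul], by simp⟩

theorem card_intCast_mul_eq_le {h : ℤ} (hh : h ≠ 0) (t : ZMod q) :
    (Finset.univ.filter fun x : ZMod q => (h : ZMod q) * x = t).card ≤ h.natAbs := by
  rcases (Finset.univ.filter fun x : ZMod q => (h : ZMod q) * x = t).eq_empty_or_nonempty with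
    h0 | ⟨y, hy⟩
  · simp [h0]
  have hy := (Finset.mem_filter.1 hy).2
  refine le_trans ?_ ((card_natCast_mul_eq_zero_le q h.natAbs).trans
    (Nat.gcd_le_left _ (Int.natAbs_pos.2 hh)))
  refine Finset.card_le_card_of_injOn (fun x => x - y) (fun x hx => ?_)
    (fun a _ b _ hab => by simpa using hab)
  have hx := (Finset.mem_filter.1 (Finset.mem_coe.1 hx)).2
  have h1 : (h : ZMod q) * (x - y) = 0 := by rw [mul_sub, hx, hy, sub_self]
  simp only [Finset.coe_filter, Finset.mem_univ, true_and, mem_ofPred_eq]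
  rcases Int.natAbs_eq h with h2 | h2
  · rw [h2] at h1; simpa using h1
  · rw [h2] at h1; simpa using h1

/-- Parseval's identity for the function that counts the values of `(f, g)` modulo `q`. -/
theorem sum_norm_sq_charSum {X : Type*} [Fintype X] (f g : X → ZMod q) :
    ∑ h : ZMod q, ∑ k : ZMod q, ‖∑ x, (ZMod.stdAddChar (h * f x + k * g x) : ℂ)‖ ^ 2 =
      (q : ℝ) ^ 2 *
        (Finset.univ.filter fun p : X × X => f p.1 = f p.2 ∧ g p.1 = g p.2).card := by
  have key : ∀ h k : ZMod q, ((‖∑ x, (ZMod.stdAddChar (h * f x + k * g x) : ℂ)‖ ^ 2 : ℝ) : ℂ) =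
      ∑ p : X × X, (ZMod.stdAddChar (h * (f p.1 - f p.2)) : ℂ) *
        ZMod.stdAddChar (k * (g p.1 - g p.2)) := by
    intro h k
    rw [Complex.ofReal_pow, ← Complex.mul_conj', map_sum, Finset.sum_mul_sum,
      Fintype.sum_prod_type]
    refine Finset.sum_congr rfl fun x _ => Finset.sum_congr rfl fun y _ => ?_
    rw [← AddChar.map_neg_eq_conj, ← AddChar.map_add_eq_mul, ← AddChar.map_add_eq_mul]
    congr 1
    ring
  have hs : ∀ b : ZMod q, ∑ x : ZMod q, (ZMod.stdAddChar (x * b) : ℂ) =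
      if b = 0 then (q : ℂ) else 0 := by
    intro b
    rw [AddChar.sum_mulShift b (ZMod.isPrimitive_stdAddChar q)]
    simp
  apply Complex.ofReal_injective
  rw [Complex.ofReal_sum]
  simp_rw [Complex.ofReal_sum, key]
  rw [Finset.sum_congr rfl fun h _ => Finset.sum_comm, Finset.sum_comm]
  simp_rw [← Finset.mul_sum, ← Finset.sum_mul, hs]
  rw [Finset.card_filter]
  push_cast
  rw [Finset.mul_sum]
  refine Finset.sum_congr rfl fun p _ => ?_
  by_cases h1 : f p.1 = f p.2 <;> by_cases h2 : g p.1 = g p.2 <;> simp [h1, h2, sub_eq_zero, sq]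

theorem sum_gcd_val_le : ∑ s : ZMod q, s.val.gcd q ≤ q * q.divisors.card := by
  have h1 : ∀ s : ZMod q, s.val.gcd q ≤ ∑ d ∈ q.divisors, if d ∣ s.val then d else 0 := by
    intro s
    have hm : s.val.gcd q ∈ q.divisors :=
      Nat.mem_divisors.2 ⟨Nat.gcd_dvd_right _ _, NeZero.ne q⟩
    refine le_trans ?_ (Finset.single_le_sum (fun _ _ => Nat.zero_le _) hm)
    rw [if_pos (Nat.gcd_dvd_left _ _)]
  refine (Finset.sum_le_sum fun s _ => h1 s).trans ?_
  rw [Finset.sum_comm, mul_comm, ← smul_eq_mul, ← Finset.sum_const]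
  refine Finset.sum_le_sum fun d hd => ?_
  obtain ⟨e, he⟩ := Nat.dvd_of_mem_divisors hd
  have hq : 0 < q := NeZero.pos q
  have hd0 : 0 < d := Nat.pos_of_mem_divisors hd
  rw [← Finset.sum_filter, Finset.sum_const, smul_eq_mul]
  have : (Finset.univ.filter fun s : ZMod q => d ∣ s.val).card ≤ (Finset.range e).card := by
    refine Finset.card_le_card_of_injOn (fun s => s.val / d) (fun s _ => ?_) (fun a ha b hb hab => ?_)
    · simp only [Finset.coe_range, mem_Iio]
      rw [Nat.div_lt_iff_lt_mul hd0, mul_comm, ← he]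
      exact ZMod.val_lt s
    · have ha := (Finset.mem_filter.1 (Finset.mem_coe.1 ha)).2
      have hb := (Finset.mem_filter.1 (Finset.mem_coe.1 hb)).2
      apply ZMod.val_injective q
      rw [← Nat.div_mul_cancel ha, ← Nat.div_mul_cancel hb]
      simp only at hab
      rw [hab]
  rw [Finset.card_range] at this
  nlinarith

theorem card_triple_mul_eq_zero_le :
    (Finset.univ.filter fun t : ZMod q × ZMod q × ZMod q => t.1 * t.2.1 * t.2.2 = 0).card ≤
      (q * q.divisors.card) ^ 2 := by
  have h1 : (Finset.univ.filter fun t : ZMod q × ZMod q × ZMod q => t.1 * t.2.1 * t.2.2 = 0).card =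
      ∑ s : ZMod q, ∑ u : ZMod q, (Finset.univ.filter fun v : ZMod q => s * u * v = 0).card := by
    simp_rw [Finset.card_filter]
    rw [Fintype.sum_prod_type]
    refine Finset.sum_congr rfl fun s _ => ?_
    rw [Fintype.sum_prod_type]
  have h2 : ∀ s u : ZMod q, (Finset.univ.filter fun v : ZMod q => s * u * v = 0).card ≤
      s.val.gcd q * u.val.gcd q := by
    intro s u
    have := card_natCast_mul_eq_zero_le q (s.val * u.val)
    simp only [Nat.cast_mul, ZMod.natCast_val, ZMod.cast_id', id_eq] at this
    refine this.trans (Nat.le_of_dvd (Nat.mul_pos (Nat.gcd_pos_of_pos_right _ (NeZero.pos q))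
      (Nat.gcd_pos_of_pos_right _ (NeZero.pos q))) ?_)
    exact Nat.gcd_mul_left_dvd_mul_gcd _ _ _
  rw [h1, sq]
  refine (Finset.sum_le_sum fun s _ => Finset.sum_le_sum fun u _ => h2 s u).trans ?_
  rw [← Finset.sum_mul_sum]
  exact Nat.mul_le_mul (sum_gcd_val_le q) (sum_gcd_val_le q)

/-- The number of solutions of `a + b = c + d`, `a⁻¹ + b⁻¹ = c⁻¹ + d⁻¹` in units. These equations
force `(a + b) (c - a) (c - b) = 0`, and `(a, b, c)` is recovered from these three factors up to
the two-fold ambiguity of dividing by `2`. -/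
theorem card_kloosterman_quadruples_le :
    (Finset.univ.filter fun p : ((ZMod q)ˣ × (ZMod q)ˣ) × ((ZMod q)ˣ × (ZMod q)ˣ) =>
      (p.1.1 + p.1.2 : ZMod q) = p.2.1 + p.2.2 ∧
      (((p.1.1⁻¹ : (ZMod q)ˣ) : ZMod q) + ((p.1.2⁻¹ : (ZMod q)ˣ) : ZMod q)) =
        ((p.2.1⁻¹ : (ZMod q)ˣ) : ZMod q) + ((p.2.2⁻¹ : (ZMod q)ˣ) : ZMod q)).card ≤
      2 * (q * q.divisors.card) ^ 2 := by
  refine le_trans ?_ (Nat.mul_le_mul_left 2 (card_triple_mul_eq_zero_le q))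
  refine Finset.card_le_mul_card_image_of_maps_to
    (f := fun p : ((ZMod q)ˣ × (ZMod q)ˣ) × ((ZMod q)ˣ × (ZMod q)ˣ) =>
      ((p.1.1 + p.1.2 : ZMod q), (p.2.1 - p.1.1 : ZMod q), (p.2.1 - p.1.2 : ZMod q)))
    ?_ 2 ?_
  · rintro ⟨⟨a, b⟩, ⟨c, d⟩⟩ hp
    simp only [Finset.mem_filter, Finset.mem_univ, true_and] at hp ⊢
    obtain ⟨h1, h2⟩ := hp
    have ha : (a : ZMod q) * ((a⁻¹ : (ZMod q)ˣ) : ZMod q) = 1 := a.mul_inv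
    have hb : (b : ZMod q) * ((b⁻¹ : (ZMod q)ˣ) : ZMod q) = 1 := b.mul_inv
    have hc : (c : ZMod q) * ((c⁻¹ : (ZMod q)ˣ) : ZMod q) = 1 := c.mul_inv
    have hd : (d : ZMod q) * ((d⁻¹ : (ZMod q)ˣ) : ZMod q) = 1 := d.mul_inv
    generalize ((a⁻¹ : (ZMod q)ˣ) : ZMod q) = a' at *
    generalize ((b⁻¹ : (ZMod q)ˣ) : ZMod q) = b' at *
    generalize ((c⁻¹ : (ZMod q)ˣ) : ZMod q) = c' at *
    generalize ((d⁻¹ : (ZMod q)ˣ) : ZMod q) = d' at *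
    generalize (a : ZMod q) = a at *
    generalize (b : ZMod q) = b at *
    generalize (c : ZMod q) = c at *
    generalize (d : ZMod q) = d at *
    have e1 : (a + b) * (c * d) = (c + d) * (a * b) := by
      have e2 : (a' + b') * (a * b * (c * d)) = (a + b) * (c * d) := by
        linear_combination (b * (c * d)) * ha + (a * (c * d)) * hb
      have e3 : (c' + d') * (a * b * (c * d)) = (c + d) * (a * b) := by
        linear_combination (a * b * d) * hc + (a * b * c) * hd
      rw [← e2, ← e3, h2]
    have hdd : d = a + b - c := by linear_combination -h1
    subst hdd
    linear_combination -e1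
  · rintro ⟨s, u, v⟩ -
    have h2 := card_intCast_mul_eq_le q (two_ne_zero (α := ℤ)) (s + u - v)
    refine le_trans ?_ h2
    refine Finset.card_le_card_of_injOn (fun p => (p.1.2 : ZMod q)) ?_ ?_
    · rintro ⟨⟨a, b⟩, ⟨c, d⟩⟩ hp
      simp only [Finset.coe_filter, Finset.mem_filter, Finset.mem_univ, true_and, mem_ofPred_eq,
        Prod.mk.injEq] at hp ⊢
      obtain ⟨-, h1, h2, h3⟩ := hp
      rw [← h1, ← h2, ← h3]
      push_cast
      ring
    · rintro ⟨⟨a, b⟩, ⟨c, d⟩⟩ hp ⟨⟨a', b'⟩, ⟨c', d'⟩⟩ hp' hbb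
      simp only [Finset.coe_filter, Finset.mem_filter, Finset.mem_univ, true_and, mem_ofPred_eq,
        Prod.mk.injEq] at hp hp' hbb
      obtain ⟨⟨h0, -⟩, h1, h2, h3⟩ := hp
      obtain ⟨⟨h0', -⟩, h1', h2', h3'⟩ := hp'
      have ha : (a : ZMod q) = a' := by linear_combination h1 - h1' - hbb
      have hc : (c : ZMod q) = c' := by linear_combination h3 - h3' + hbb
      have hd : (d : ZMod q) = d' := by linear_combination h0' - h0 + ha + hbb - hc
      simp only [Prod.mk.injEq]
      exact ⟨⟨Units.ext ha, Units.ext hbb⟩, Units.ext hc, Units.ext hd⟩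

theorem sum_norm_kloosterman_pow_four_le :
    ∑ h : ZMod q, ∑ k : ZMod q, ‖kloosterman q h k‖ ^ 4 ≤
      2 * (q : ℝ) ^ 4 * (q.divisors.card : ℝ) ^ 2 := by
  have h1 : ∀ h k : ZMod q, ‖kloosterman q h k‖ ^ 4 =
      ‖∑ x : (ZMod q)ˣ × (ZMod q)ˣ, (ZMod.stdAddChar (h * (x.1 + x.2 : ZMod q) +
        k * (((x.1⁻¹ : (ZMod q)ˣ) : ZMod q) + ((x.2⁻¹ : (ZMod q)ˣ) : ZMod q))) : ℂ)‖ ^ 2 := by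
    intro h k
    rw [show (4 : ℕ) = 2 * 2 from rfl, pow_mul, ← norm_pow]
    congr 2
    rw [sq, kloosterman, Finset.sum_mul_sum, Fintype.sum_prod_type]
    refine Finset.sum_congr rfl fun x _ => Finset.sum_congr rfl fun y _ => ?_
    rw [← AddChar.map_add_eq_mul]
    congr 1
    ring
  simp_rw [h1]
  rw [sum_norm_sq_charSum]
  have h2 := card_kloosterman_quadruples_le q
  have h3 := (Nat.cast_le (α := ℝ)).2 h2
  push_cast at h3
  calc _ ≤ (q : ℝ) ^ 2 * (2 * (q * (q.divisors.card : ℝ)) ^ 2) :=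
        mul_le_mul_of_nonneg_left h3 (by positivity)
    _ = _ := by ring

/-- A power-saving bound for Kloosterman sums: by `kloosterman_smul` the value at `(h, k)` is
attained at the `φ(q)` points `(h u, k u⁻¹)`, each of which is hit at most `|h|` times. -/
theorem totient_mul_norm_kloosterman_pow_four_le {h : ℤ} (hh : h ≠ 0) (k : ZMod q) :
    (q.totient : ℝ) * ‖kloosterman q h k‖ ^ 4 ≤
      h.natAbs * (2 * (q : ℝ) ^ 4 * (q.divisors.card : ℝ) ^ 2) := by
  refine le_trans ?_ (mul_le_mul_of_nonneg_left (sum_norm_kloosterman_pow_four_le q)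
    (Nat.cast_nonneg _))
  have h1 : (q.totient : ℝ) * ‖kloosterman q h k‖ ^ 4 =
      ∑ u : (ZMod q)ˣ, ‖kloosterman q (h * u) (k * ((u⁻¹ : (ZMod q)ˣ) : ZMod q))‖ ^ 4 := by
    simp_rw [kloosterman_smul]
    rw [Finset.sum_const, nsmul_eq_mul, Finset.card_univ, ZMod.card_units_eq_totient]
  rw [h1, ← Fintype.sum_prod_type'
    (f := fun h k : ZMod q => ‖kloosterman q h k‖ ^ 4), Finset.mul_sum,
    ← Finset.sum_fiberwise (s := Finset.univ)
      (g := fun u : (ZMod q)ˣ => ((h * u : ZMod q), k * ((u⁻¹ : (ZMod q)ˣ) : ZMod q)))]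
  refine Finset.sum_le_sum fun p _ => ?_
  rw [Finset.sum_congr rfl (g := fun _ => ‖kloosterman q p.1 p.2‖ ^ 4) (fun u hu => by
    have := (Finset.mem_filter.1 hu).2
    rw [← this]), Finset.sum_const, nsmul_eq_mul]
  refine mul_le_mul_of_nonneg_right (Nat.cast_le.2 ?_) (by positivity)
  refine le_trans ?_ (card_intCast_mul_eq_le q hh p.1)
  refine Finset.card_le_card_of_injOn (fun u => (u : ZMod q)) (fun u hu => ?_)
    (fun a _ b _ hab => Units.ext hab)
  have := (Finset.mem_filter.1 (Finset.mem_coe.1 hu)).2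
  simp [← this]

theorem norm_kloosterman_pow_four_le {h : ℤ} (hh : h ≠ 0) (k : ZMod q) :
    ‖kloosterman q h k‖ ^ 4 ≤ 2 * h.natAbs * (q : ℝ) ^ 3 * (q.divisors.card : ℝ) ^ 3 := by
  have h1 := totient_mul_norm_kloosterman_pow_four_le q hh k
  have h2 : (q : ℝ) ≤ q.totient * q.divisors.card := by
    exact_mod_cast le_totient_mul_card_divisors q
  have hq : (0 : ℝ) < q := Nat.cast_pos.2 (NeZero.pos q)
  refine le_of_mul_le_mul_left ?_ hq
  calc (q : ℝ) * ‖kloosterman q h k‖ ^ 4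
      ≤ (q.totient * q.divisors.card) * ‖kloosterman q h k‖ ^ 4 :=
        mul_le_mul_of_nonneg_right h2 (by positivity)
    _ = q.divisors.card * (q.totient * ‖kloosterman q h k‖ ^ 4) := by ring
    _ ≤ q.divisors.card * (h.natAbs * (2 * (q : ℝ) ^ 4 * (q.divisors.card : ℝ) ^ 2)) :=
        mul_le_mul_of_nonneg_left h1 (Nat.cast_nonneg _)
    _ = _ := by ring

/-- With the divisor bound, `‖K(h, k; q)‖ ^ 16 ≪ q ^ 15` for fixed `h`. -/
theorem norm_kloosterman_pow_sixteen_le {h : ℤ} (hh : h ≠ 0) (k : ZMod q) :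
    ‖kloosterman q h k‖ ^ 16 ≤ (2 * h.natAbs) ^ 4 * (41 ^ 16) ^ 3 * (q : ℝ) ^ 15 := by
  have h1 := pow_le_pow_left₀ (by positivity) (norm_kloosterman_pow_four_le q hh k) 4
  have h2 : (q.divisors.card : ℝ) ^ 4 ≤ 41 ^ 16 * q := by
    exact_mod_cast card_divisors_pow_four_le (NeZero.ne q)
  calc ‖kloosterman q h k‖ ^ 16 = (‖kloosterman q h k‖ ^ 4) ^ 4 := by ring
    _ ≤ _ := h1
    _ = (2 * h.natAbs) ^ 4 * (q : ℝ) ^ 12 * ((q.divisors.card : ℝ) ^ 4) ^ 3 := by ring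
    _ ≤ (2 * h.natAbs) ^ 4 * (q : ℝ) ^ 12 * (41 ^ 16 * q) ^ 3 := by gcongr
    _ = _ := by ring

end Kloosterman

/-! ### Joint equidistribution of units and their inverses -/

/-- The deviation of the points `(u / q, u⁻¹ / q)`, `u` a unit modulo `q`, from equidistribution
on the torus, measured by the test function `f ⊗ g`. -/
noncomputable def unitDiscrepancy (q : ℕ) [NeZero q] (f g : C(UnitAddCircle, ℂ)) : ℂ :=
  ∑ u : (ZMod q)ˣ, f (ZMod.toAddCircle (u : ZMod q)) *
    g (ZMod.toAddCircle ((u⁻¹ : (ZMod q)ˣ) : ZMod q)) -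
    q.totient * ((∫ x, f x) * ∫ x, g x)

theorem continuousMap_integrable (f : C(UnitAddCircle, ℂ)) :
    Integrable f (volume : Measure UnitAddCircle) :=
  f.continuous.integrable_of_hasCompactSupport (HasCompactSupport.of_compactSpace f)

theorem norm_integral_continuousMap_le (f : C(UnitAddCircle, ℂ)) : ‖∫ x, f x‖ ≤ ‖f‖ := by
  have h := norm_integral_le_of_norm_le_const (μ := (volume : Measure UnitAddCircle)) (f := f)
    (C := ‖f‖) (Eventually.of_forall fun x => f.norm_coe_le_norm x)
  simpa [Measure.real, UnitAddCircle.measure_univ] using h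

section Discrepancy

variable (q : ℕ) [NeZero q]

theorem unitDiscrepancy_add (f₁ f₂ g : C(UnitAddCircle, ℂ)) :
    unitDiscrepancy q (f₁ + f₂) g = unitDiscrepancy q f₁ g + unitDiscrepancy q f₂ g := by
  unfold unitDiscrepancy
  simp only [ContinuousMap.add_apply, add_mul, Finset.sum_add_distrib]
  rw [integral_add (continuousMap_integrable f₁) (continuousMap_integrable f₂)]
  ring

theorem unitDiscrepancy_smul (c : ℂ) (f g : C(UnitAddCircle, ℂ)) :
    unitDiscrepancy q (c • f) g = c * unitDiscrepancy q f g := by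
  unfold unitDiscrepancy
  simp only [ContinuousMap.smul_apply, smul_eq_mul, integral_const_mul, mul_assoc, mul_sub,
    Finset.mul_sum]
  ring

theorem unitDiscrepancy_comm (f g : C(UnitAddCircle, ℂ)) :
    unitDiscrepancy q f g = unitDiscrepancy q g f := by
  unfold unitDiscrepancy
  rw [mul_comm (∫ x, f x)]
  congr 1
  refine Fintype.sum_equiv (Equiv.inv _) _ _ fun u => ?_
  simp [mul_comm]

theorem norm_unitDiscrepancy_le (f g : C(UnitAddCircle, ℂ)) :
    ‖unitDiscrepancy q f g‖ ≤ 2 * q * (‖f‖ * ‖g‖) := by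
  have hφ : (q.totient : ℝ) ≤ q := Nat.cast_le.2 (Nat.totient_le q)
  have h1 : ‖∑ u : (ZMod q)ˣ, f (ZMod.toAddCircle (u : ZMod q)) *
      g (ZMod.toAddCircle ((u⁻¹ : (ZMod q)ˣ) : ZMod q))‖ ≤ q.totient * (‖f‖ * ‖g‖) := by
    refine (norm_sum_le _ _).trans ?_
    rw [← ZMod.card_units_eq_totient, ← Finset.card_univ, ← nsmul_eq_mul, ← Finset.sum_const]
    refine Finset.sum_le_sum fun u _ => ?_
    rw [norm_mul]
    exact mul_le_mul (f.norm_coe_le_norm _) (g.norm_coe_le_norm _) (norm_nonneg _) (norm_nonneg _)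
  have h2 : ‖(q.totient : ℂ) * ((∫ x, f x) * ∫ x, g x)‖ ≤ q.totient * (‖f‖ * ‖g‖) := by
    rw [norm_mul, norm_mul, Complex.norm_natCast]
    refine mul_le_mul_of_nonneg_left ?_ (Nat.cast_nonneg _)
    exact mul_le_mul (norm_integral_continuousMap_le f) (norm_integral_continuousMap_le g)
      (norm_nonneg _) (norm_nonneg _)
  calc ‖unitDiscrepancy q f g‖ ≤ _ := norm_sub_le _ _
    _ ≤ q.totient * (‖f‖ * ‖g‖) + q.totient * (‖f‖ * ‖g‖) := add_le_add h1 h2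
    _ = 2 * q.totient * (‖f‖ * ‖g‖) := by ring
    _ ≤ _ := by gcongr

theorem fourier_toAddCircle (h : ℤ) (t : ZMod q) :
    (fourier h (ZMod.toAddCircle t : UnitAddCircle) : ℂ) = ZMod.stdAddChar ((h : ZMod q) * t) := by
  rw [fourier_apply, ZMod.stdAddChar_apply, ZMod.toCircle, ← map_zsmul, zsmul_eq_mul]
  rfl

end Discrepancy

theorem integral_fourier_eq_zero {h : ℤ} (hh : h ≠ 0) :
    ∫ x : UnitAddCircle, (fourier h x : ℂ) = 0 :=
  integral_eq_zero_of_add_right_eq_neg (fourier_add_half_inv_index hh one_pos)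

/-- The deviation from equidistribution for `f ⊗ g` is `o(q)`. -/
def UnitEquidistributed (f g : C(UnitAddCircle, ℂ)) : Prop :=
  ∀ ε > 0, ∀ᶠ q : ℕ in atTop, ∀ _ : NeZero q, ‖unitDiscrepancy q f g‖ ≤ ε * q

theorem UnitEquidistributed.symm {f g : C(UnitAddCircle, ℂ)} (h : UnitEquidistributed f g) :
    UnitEquidistributed g f := by
  intro ε hε
  filter_upwards [h ε hε] with q hq hq0
  rw [unitDiscrepancy_comm]
  exact hq hq0

theorem unitEquidistributed_fourier_of_ne_zero {h : ℤ} (hh : h ≠ 0) (k : ℤ) :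
    UnitEquidistributed (fourier h) (fourier k) := by
  intro ε hε
  filter_upwards [eventually_ge_atTop
    ⌈(2 * h.natAbs : ℝ) ^ 4 * (41 ^ 16) ^ 3 / ε ^ 16⌉₊] with q hq hq0
  have hK : unitDiscrepancy q (fourier h) (fourier k) = kloosterman q h k := by
    unfold unitDiscrepancy kloosterman
    rw [integral_fourier_eq_zero hh]
    simp only [zero_mul, mul_zero, sub_zero]
    refine Finset.sum_congr rfl fun u _ => ?_
    rw [fourier_toAddCircle, fourier_toAddCircle, AddChar.map_add_eq_mul]
  rw [hK]
  refine le_of_pow_le_pow_left₀ (n := 16) (by norm_num) (by positivity) ?_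
  refine (norm_kloosterman_pow_sixteen_le q hh k).trans ?_
  have h1 := (div_le_iff₀ (by positivity)).1 (Nat.ceil_le.1 hq)
  calc _ ≤ (q * ε ^ 16) * (q : ℝ) ^ 15 := by gcongr
    _ = _ := by ring

theorem unitEquidistributed_fourier (h k : ℤ) :
    UnitEquidistributed (fourier h) (fourier k) := by
  by_cases hh : h = 0
  · by_cases hk : k = 0
    · intro ε hε
      refine Eventually.of_forall fun q hq0 => ?_
      have : unitDiscrepancy q (fourier h) (fourier k) = 0 := by
        subst hh hk
        simp [unitDiscrepancy, Measure.real]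
      rw [this, norm_zero]
      positivity
    · exact (unitEquidistributed_fourier_of_ne_zero hk h).symm
  · exact unitEquidistributed_fourier_of_ne_zero hh k

/-- Test functions in one variable extend from trigonometric monomials to all continuous
functions, by density. -/
theorem UnitEquidistributed.of_fourier {g : C(UnitAddCircle, ℂ)}
    (hg : ∀ h : ℤ, UnitEquidistributed (fourier h) g) (f : C(UnitAddCircle, ℂ)) :
    UnitEquidistributed f g := by
  have hspan : ∀ f ∈ Submodule.span ℂ (range (fourier (T := 1))), UnitEquidistributed f g := by
    intro f hf
    induction hf using Submodule.span_induction with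
    | mem x hx => obtain ⟨h, rfl⟩ := hx; exact hg h
    | zero =>
      intro ε hε
      refine Eventually.of_forall fun q hq0 => ?_
      have : unitDiscrepancy q 0 g = 0 := by simp [unitDiscrepancy]
      rw [this, norm_zero]
      positivity
    | add x y _ _ hx hy =>
      intro ε hε
      filter_upwards [hx (ε / 2) (half_pos hε), hy (ε / 2) (half_pos hε)] with q h1 h2 hq0
      rw [unitDiscrepancy_add]
      refine (norm_add_le _ _).trans ((add_le_add (h1 hq0) (h2 hq0)).trans_eq ?_)
      ring
    | smul c x _ hx =>
      intro ε hε
      filter_upwards [hx (ε / (‖c‖ + 1)) (by positivity)] with q h1 hq0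
      rw [unitDiscrepancy_smul, norm_mul]
      calc ‖c‖ * ‖unitDiscrepancy q x g‖ ≤ (‖c‖ + 1) * (ε / (‖c‖ + 1) * q) := by
            gcongr
            · linarith
            · exact h1 hq0
        _ = ε * q := by field_simp
  intro ε hε
  have hf : f ∈ closure (Submodule.span ℂ (range (fourier (T := 1))) : Set C(UnitAddCircle, ℂ)) := by
    have := span_fourier_closure_eq_top (T := 1)
    rw [← Submodule.topologicalClosure_coe, this]
    trivial
  obtain ⟨f', hf', hd⟩ := Metric.mem_closure_iff.1 hf (ε / (4 * (‖g‖ + 1))) (by positivity)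
  rw [dist_eq_norm] at hd
  filter_upwards [hspan f' hf' (ε / 2) (half_pos hε)] with q h1 hq0
  have e : f = f' + (f - f') := by abel
  rw [e, unitDiscrepancy_add]
  have h2 := norm_unitDiscrepancy_le q (f - f') g
  have h3 : ‖f - f'‖ * ‖g‖ ≤ ε / 4 := by
    calc ‖f - f'‖ * ‖g‖ ≤ ε / (4 * (‖g‖ + 1)) * (‖g‖ + 1) := by
          gcongr
          linarith
      _ = ε / 4 := by field_simp
  calc _ ≤ _ := norm_add_le _ _
    _ ≤ ε / 2 * q + 2 * q * (ε / 4) := by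
        refine add_le_add (h1 hq0) (h2.trans ?_)
        gcongr
    _ = ε * q := by ring

theorem unitEquidistributed (f g : C(UnitAddCircle, ℂ)) : UnitEquidistributed f g :=
  UnitEquidistributed.of_fourier
    (fun h => (UnitEquidistributed.of_fourier (fun k => unitEquidistributed_fourier k h) g).symm) f

open Classical in
/-- An upper bound for the number of units `u` with `(u / q, u⁻¹ / q)` in a product of compact
sets. -/
theorem card_units_mem_le {E F : Set UnitAddCircle} (hE : IsClosed E) (hF : IsClosed F)
    {ε : ℝ} (hε : 0 < ε) :
    ∀ᶠ q : ℕ in atTop, ∀ _ : NeZero q,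
      ((Finset.univ.filter fun u : (ZMod q)ˣ => ZMod.toAddCircle (u : ZMod q) ∈ E ∧
        ZMod.toAddCircle ((u⁻¹ : (ZMod q)ˣ) : ZMod q) ∈ F).card : ℝ) ≤
      q.totient * (volume.real E * volume.real F) + ε * q := by
  set η : ℝ := min 1 (ε / 6) with hη
  have hη0 : 0 < η := by positivity
  have approx : ∀ E : Set UnitAddCircle, IsClosed E → ∃ f : UnitAddCircle → ℝ, Continuous f ∧
      EqOn f 1 E ∧ 0 ≤ f ∧ ∫ x, f x ≤ volume.real E + η := by
    intro E hE
    have h1 := hE.isCompact.measure_eq_biInf_integral_hasCompactSupport volume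
    have h2 : volume E < volume E + ENNReal.ofReal η :=
      ENNReal.lt_add_right (measure_ne_top _ _) (by simpa using hη0)
    nth_rewrite 1 [h1] at h2
    simp only [iInf_lt_iff, exists_prop] at h2
    obtain ⟨f, hf, -, hf1, hf0, hlt⟩ := h2
    refine ⟨f, hf, hf1, hf0, ?_⟩
    have h3 := (ENNReal.ofReal_le_iff_le_toReal (by finiteness)).1 hlt.le
    rwa [ENNReal.toReal_add (measure_ne_top _ _) (by finiteness),
      ENNReal.toReal_ofReal hη0.le] at h3
  obtain ⟨f, hfc, hf1, hf0, hfi⟩ := approx E hE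
  obtain ⟨g, hgc, hg1, hg0, hgi⟩ := approx F hF
  filter_upwards [unitEquidistributed ⟨fun x => (f x : ℂ), by fun_prop⟩
    ⟨fun x => (g x : ℂ), by fun_prop⟩ (ε / 2) (half_pos hε)] with q hq hq0
  have h1 := hq hq0
  have h2 : unitDiscrepancy q ⟨fun x => (f x : ℂ), by fun_prop⟩ ⟨fun x => (g x : ℂ), by fun_prop⟩ =
      ((∑ u : (ZMod q)ˣ, f (ZMod.toAddCircle (u : ZMod q)) *
        g (ZMod.toAddCircle ((u⁻¹ : (ZMod q)ˣ) : ZMod q)) -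
        q.totient * ((∫ x, f x) * ∫ x, g x) : ℝ) : ℂ) := by
    simp only [unitDiscrepancy, ContinuousMap.coe_mk, integral_complex_ofReal]
    push_cast
    rfl
  rw [h2, Complex.norm_real, Real.norm_eq_abs] at h1
  have h3 := (abs_le.1 h1).2
  have h4 : ((Finset.univ.filter fun u : (ZMod q)ˣ => ZMod.toAddCircle (u : ZMod q) ∈ E ∧
        ZMod.toAddCircle ((u⁻¹ : (ZMod q)ˣ) : ZMod q) ∈ F).card : ℝ) ≤
      ∑ u : (ZMod q)ˣ, f (ZMod.toAddCircle (u : ZMod q)) *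
        g (ZMod.toAddCircle ((u⁻¹ : (ZMod q)ˣ) : ZMod q)) := by
    rw [Finset.card_filter]
    push_cast
    refine Finset.sum_le_sum fun u _ => ?_
    split_ifs with hu
    · rw [hf1 hu.1, hg1 hu.2]; simp
    · exact mul_nonneg (hf0 _) (hg0 _)
  have h5 : (∫ x, f x) * ∫ x, g x ≤ volume.real E * volume.real F + 3 * η := by
    have hE1 : volume.real E ≤ 1 := by
      have := measureReal_mono (μ := (volume : Measure UnitAddCircle)) (subset_univ E)
      simpa [Measure.real, UnitAddCircle.measure_univ] using this
    have hF1 : volume.real F ≤ 1 := by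
      have := measureReal_mono (μ := (volume : Measure UnitAddCircle)) (subset_univ F)
      simpa [Measure.real, UnitAddCircle.measure_univ] using this
    calc (∫ x, f x) * ∫ x, g x ≤ (volume.real E + η) * (volume.real F + η) :=
          mul_le_mul hfi hgi (integral_nonneg hg0) (by positivity)
      _ ≤ _ := by nlinarith [min_le_left 1 (ε / 6)]
  have hφ : (q.totient : ℝ) ≤ q := Nat.cast_le.2 (Nat.totient_le q)
  have h6 : (q.totient : ℝ) * (3 * η) ≤ q * (ε / 2) := by
    have : 3 * η ≤ ε / 2 := by linarith [min_le_right 1 (ε / 6)]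
    gcongr
  have h7 := mul_le_mul_of_nonneg_left h5 (Nat.cast_nonneg (α := ℝ) q.totient)
  linarith

/-! ### Boxes and windows of residues -/

/-- The arc of the circle that is the image of `[x, y]`, written as a closed ball. -/
def circleArc (x y : ℝ) : Set UnitAddCircle :=
  Metric.closedBall (((x + y) / 2 : ℝ) : UnitAddCircle) ((y - x) / 2)

theorem isClosed_circleArc (x y : ℝ) : IsClosed (circleArc x y) := Metric.isClosed_closedBall

theorem coe_mem_circleArc {x y z : ℝ} (h1 : x ≤ z) (h2 : z ≤ y) :
    (z : UnitAddCircle) ∈ circleArc x y := by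
  rw [circleArc, Metric.mem_closedBall, dist_eq_norm, ← AddCircle.coe_sub]
  refine QuotientAddGroup.norm_mk_le_norm.trans ?_
  rw [Real.norm_eq_abs, abs_le]
  constructor <;> linarith

theorem volume_circleArc_le {x y : ℝ} (h : x ≤ y) : volume.real (circleArc x y) ≤ y - x := by
  rw [circleArc, Measure.real, AddCircle.volume_closedBall]
  refine ENNReal.toReal_le_of_le_ofReal (by linarith) (ENNReal.ofReal_le_ofReal ?_)
  refine (min_le_right _ _).trans ?_
  linarith

theorem card_units_box_le {c d : ℝ} (hcd : c ≤ d) {ε : ℝ} (hε : 0 < ε)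
    {α β : ℝ} (hαβ : α ≤ β) :
    ∀ᶠ q : ℕ in atTop, ∀ _ : NeZero q,
      ((Finset.univ.filter fun u : (ZMod q)ˣ => (α ≤ (u : ZMod q).val / (q : ℝ) ∧
        (u : ZMod q).val / (q : ℝ) ≤ β) ∧ c ≤ (-(u : ZMod q)⁻¹).val / (q : ℝ) ∧
          (-(u : ZMod q)⁻¹).val / (q : ℝ) ≤ d).card : ℝ) ≤
      q.totient * ((β - α) * (d - c)) + ε * q := by
  filter_upwards [card_units_mem_le (isClosed_circleArc α β) (isClosed_circleArc (-d) (-c)) hε]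
    with q hq hq0
  have h1 := hq hq0
  refine le_trans (Nat.cast_le.2 (Finset.card_le_card ?_)) (h1.trans ?_)
  · intro u hu
    simp only [Finset.mem_filter, Finset.mem_univ, true_and] at hu ⊢
    obtain ⟨⟨h2, h3⟩, h4, h5⟩ := hu
    constructor
    · rw [ZMod.toAddCircle_apply]
      exact coe_mem_circleArc h2 h3
    · have : ((u⁻¹ : (ZMod q)ˣ) : ZMod q) = -(-(u : ZMod q)⁻¹) := by
        rw [neg_neg, ZMod.inv_coe_unit]
      rw [this, map_neg, ZMod.toAddCircle_apply, ← AddCircle.coe_neg]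
      exact coe_mem_circleArc (by linarith) (by linarith)
  · have h2 := volume_circleArc_le hαβ
    have h3 := volume_circleArc_le (neg_le_neg hcd)
    have h4 : volume.real (circleArc α β) * volume.real (circleArc (-d) (-c)) ≤
        (β - α) * (d - c) := by
      refine mul_le_mul h2 (by linarith) measureReal_nonneg (by linarith)
    gcongr

/-- The bound of `card_units_box_le` holds uniformly in the first side of the box. -/
theorem card_units_box_le_uniform {c d : ℝ} (hc : 0 ≤ c) (hcd : c ≤ d) (hd : d ≤ 1)
    {ε : ℝ} (hε : 0 < ε) :
    ∀ᶠ q : ℕ in atTop, ∀ _ : NeZero q, ∀ α β : ℝ, 0 ≤ α → α ≤ β → β ≤ 1 →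
      ((Finset.univ.filter fun u : (ZMod q)ˣ => (α ≤ (u : ZMod q).val / (q : ℝ) ∧
        (u : ZMod q).val / (q : ℝ) ≤ β) ∧ c ≤ (-(u : ZMod q)⁻¹).val / (q : ℝ) ∧
          (-(u : ZMod q)⁻¹).val / (q : ℝ) ≤ d).card : ℝ) ≤
      q.totient * ((β - α) * (d - c)) + ε * q := by
  -- round `[α, β]` outwards to a grid of mesh `1 / M`, which leaves finitely many boxes
  obtain ⟨M, hM⟩ := exists_nat_gt (4 / ε)
  have hM0 : (0 : ℝ) < M := lt_trans (by positivity) hM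
  have h1 : ∀ᶠ q : ℕ in atTop, ∀ i ∈ Finset.range (M + 1), ∀ j ∈ Finset.range (M + 1), i ≤ j →
      ∀ _ : NeZero q,
      ((Finset.univ.filter fun u : (ZMod q)ˣ => ((i / M : ℝ) ≤ (u : ZMod q).val / (q : ℝ) ∧
        (u : ZMod q).val / (q : ℝ) ≤ (j / M : ℝ)) ∧ c ≤ (-(u : ZMod q)⁻¹).val / (q : ℝ) ∧
          (-(u : ZMod q)⁻¹).val / (q : ℝ) ≤ d).card : ℝ) ≤
      q.totient * (((j / M : ℝ) - i / M) * (d - c)) + ε / 2 * q := by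
    simp only [Filter.eventually_all_finset, Filter.eventually_imp_distrib_left]
    intro i _ j _ hij
    exact card_units_box_le hcd (half_pos hε) (by gcongr)
  filter_upwards [h1] with q hq hq0 α β hα hαβ hβ
  have hi : (⌊M * α⌋₊ : ℝ) ≤ M * α := Nat.floor_le (by positivity)
  have hi' : M * α < ⌊M * α⌋₊ + 1 := Nat.lt_floor_add_one _
  have hj : M * β ≤ (⌈M * β⌉₊ : ℝ) := Nat.le_ceil _
  have hj' : (⌈M * β⌉₊ : ℝ) < M * β + 1 := Nat.ceil_lt_add_one (by nlinarith)
  have hjM : ⌈M * β⌉₊ ≤ M := Nat.ceil_le.2 (by nlinarith)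
  have hij : ⌊M * α⌋₊ ≤ ⌈M * β⌉₊ := by
    have : (⌊M * α⌋₊ : ℝ) ≤ ⌈M * β⌉₊ := hi.trans ((by gcongr : M * α ≤ M * β).trans hj)
    exact_mod_cast this
  have h2 := hq _ (Finset.mem_range.2 (by omega : ⌊M * α⌋₊ < M + 1)) _
    (Finset.mem_range.2 (by omega : ⌈M * β⌉₊ < M + 1)) hij hq0
  refine le_trans (Nat.cast_le.2 (Finset.card_le_card ?_)) (h2.trans ?_)
  · intro u hu
    simp only [Finset.mem_filter, Finset.mem_univ, true_and] at hu ⊢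
    refine ⟨⟨le_trans ?_ hu.1.1, hu.1.2.trans ?_⟩, hu.2⟩
    · rw [div_le_iff₀ hM0]; linarith
    · rw [le_div_iff₀ hM0]; linarith
  · have hφ : (q.totient : ℝ) ≤ q := Nat.cast_le.2 (Nat.totient_le q)
    have h3 : ((⌈M * β⌉₊ / M : ℝ) - ⌊M * α⌋₊ / M) ≤ (β - α) + 2 / M := by
      rw [div_sub_div_same, div_le_iff₀ hM0]
      field_simp
      linarith
    have h4 : (2 : ℝ) / M ≤ ε / 2 := by
      rw [div_le_iff₀ hM0]
      have := (div_lt_iff₀ hε).1 hM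
      linarith
    have h5 : ((⌈M * β⌉₊ / M : ℝ) - ⌊M * α⌋₊ / M) * (d - c) ≤ (β - α) * (d - c) + ε / 2 := by
      calc _ ≤ ((β - α) + ε / 2) * (d - c) := by
            apply mul_le_mul_of_nonneg_right _ (by linarith)
            linarith
        _ ≤ (β - α) * (d - c) + ε / 2 := by nlinarith
    calc _ ≤ q.totient * ((β - α) * (d - c) + ε / 2) + ε / 2 * q := by gcongr
      _ = q.totient * ((β - α) * (d - c)) + q.totient * (ε / 2) + ε / 2 * q := by ring
      _ ≤ q.totient * ((β - α) * (d - c)) + q * (ε / 2) + ε / 2 * q := by gcongr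
      _ = _ := by ring

/-- The numerator `p` with `0 ≤ p < q` and `p n ≡ -1` modulo `q`: if `p / q` and `p' / n` are
neighbouring Farey fractions, then `p' q - p n = 1`, so that `p = fareyNumer q n`. -/
def fareyNumer (q n : ℕ) : ℕ := (-(n : ZMod q)⁻¹).val

theorem card_residues_eq (q : ℕ) [NeZero q] (c d : ℝ) {X : ℕ} (hX : X ≤ q) :
    ((Finset.range X).filter fun n => n.Coprime q ∧ c ≤ fareyNumer q n / (q : ℝ) ∧
      fareyNumer q n / (q : ℝ) < d).card =
    (Finset.univ.filter fun u : (ZMod q)ˣ => (u : ZMod q).val < X ∧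
      c ≤ (-(u : ZMod q)⁻¹).val / (q : ℝ) ∧ (-(u : ZMod q)⁻¹).val / (q : ℝ) < d).card := by
  symm
  refine Finset.card_bij (fun u _ => (u : ZMod q).val) ?_ ?_ ?_
  · intro u hu
    simp only [Finset.mem_filter, Finset.mem_univ, true_and, Finset.mem_range, fareyNumer,
      ZMod.natCast_val, ZMod.cast_id', id_eq] at hu ⊢
    exact ⟨hu.1, ZMod.val_coe_unit_coprime u, hu.2⟩
  · intro u _ v _ huv
    exact Units.ext (ZMod.val_injective q huv)
  · intro n hn
    rw [Finset.mem_filter, Finset.mem_range] at hn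
    refine ⟨ZMod.unitOfCoprime n hn.2.1, ?_, ?_⟩
    · simp only [Finset.mem_filter, Finset.mem_univ, true_and, ZMod.coe_unitOfCoprime]
      rw [ZMod.val_natCast_of_lt (hn.1.trans_le hX)]
      exact ⟨hn.1, hn.2.2⟩
    · rw [ZMod.coe_unitOfCoprime, ZMod.val_natCast_of_lt (hn.1.trans_le hX)]

/-- Equidistribution in an initial segment of residues. Upper bounds for the boxes that make up
the complement provide the lower bound. -/
theorem abs_card_residues_sub_le {c d : ℝ} (hc : 0 ≤ c) (hcd : c ≤ d) (hd : d ≤ 1)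
    {ε : ℝ} (hε : 0 < ε) :
    ∀ᶠ q : ℕ in atTop, ∀ X ≤ q,
      |(((Finset.range X).filter fun n => n.Coprime q ∧ c ≤ fareyNumer q n / (q : ℝ) ∧
        fareyNumer q n / (q : ℝ) < d).card : ℝ) - q.totient / q * (d - c) * X| ≤ ε * q := by
  filter_upwards [card_units_box_le_uniform hc hcd hd (ε := ε / 3) (by positivity),
    card_units_box_le_uniform le_rfl hc (hcd.trans hd) (ε := ε / 3) (by positivity),
    card_units_box_le_uniform (hc.trans hcd) hd le_rfl (ε := ε / 3) (by positivity),
    card_units_box_le_uniform le_rfl zero_le_one le_rfl (ε := ε / 3) (by positivity),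
    eventually_gt_atTop 0] with q h1 h2 h3 h4 hq X hX
  have hq0 : NeZero q := ⟨hq.ne'⟩
  have hqR : (0 : ℝ) < q := Nat.cast_pos.2 hq
  have hXq : (X / q : ℝ) ≤ 1 := (div_le_one hqR).2 (Nat.cast_le.2 hX)
  have hX0 : (0 : ℝ) ≤ X / q := by positivity
  have g1 := h1 hq0 0 (X / q) le_rfl hX0 hXq
  have g2 := h2 hq0 0 (X / q) le_rfl hX0 hXq
  have g3 := h3 hq0 0 (X / q) le_rfl hX0 hXq
  have g4 := h4 hq0 (X / q) 1 hX0 hXq le_rfl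
  rw [card_residues_eq q c d hX]
  have hv : ∀ v : ZMod q, (v.val : ℝ) / q < 1 := fun v => by
    rw [div_lt_one hqR]; exact_mod_cast ZMod.val_lt v
  have hlt : ∀ v : ZMod q, v.val < X → (v.val : ℝ) / q ≤ X / q := fun v h => by gcongr
  have hge : ∀ v : ZMod q, X ≤ v.val → (X / q : ℝ) ≤ v.val / q := fun v h => by gcongr
  have hup : (((Finset.univ.filter fun u : (ZMod q)ˣ => (u : ZMod q).val < X ∧
      c ≤ (-(u : ZMod q)⁻¹).val / (q : ℝ) ∧ (-(u : ZMod q)⁻¹).val / (q : ℝ) < d).card : ℕ) : ℝ) ≤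
      ((Finset.univ.filter fun u : (ZMod q)ˣ => (0 ≤ (u : ZMod q).val / (q : ℝ) ∧
        (u : ZMod q).val / (q : ℝ) ≤ X / q) ∧ c ≤ (-(u : ZMod q)⁻¹).val / (q : ℝ) ∧
          (-(u : ZMod q)⁻¹).val / (q : ℝ) ≤ d).card : ℕ) := by
    refine Nat.cast_le.2 (Finset.card_le_card fun u hu => ?_)
    simp only [Finset.mem_filter, Finset.mem_univ, true_and] at hu ⊢
    exact ⟨⟨by positivity, hlt _ hu.1⟩, hu.2.1, hu.2.2.le⟩
  set A := Finset.univ.filter fun u : (ZMod q)ˣ => (u : ZMod q).val < X ∧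
      c ≤ (-(u : ZMod q)⁻¹).val / (q : ℝ) ∧ (-(u : ZMod q)⁻¹).val / (q : ℝ) < d with hA
  set B1 := Finset.univ.filter fun u : (ZMod q)ˣ => (0 ≤ (u : ZMod q).val / (q : ℝ) ∧
        (u : ZMod q).val / (q : ℝ) ≤ X / q) ∧ 0 ≤ (-(u : ZMod q)⁻¹).val / (q : ℝ) ∧
          (-(u : ZMod q)⁻¹).val / (q : ℝ) ≤ c with hB1
  set B2 := Finset.univ.filter fun u : (ZMod q)ˣ => (0 ≤ (u : ZMod q).val / (q : ℝ) ∧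
        (u : ZMod q).val / (q : ℝ) ≤ X / q) ∧ d ≤ (-(u : ZMod q)⁻¹).val / (q : ℝ) ∧
          (-(u : ZMod q)⁻¹).val / (q : ℝ) ≤ 1 with hB2
  set B3 := Finset.univ.filter fun u : (ZMod q)ˣ => (X / q ≤ (u : ZMod q).val / (q : ℝ) ∧
        (u : ZMod q).val / (q : ℝ) ≤ 1) ∧ 0 ≤ (-(u : ZMod q)⁻¹).val / (q : ℝ) ∧
          (-(u : ZMod q)⁻¹).val / (q : ℝ) ≤ 1 with hB3
  have hcov : (q.totient : ℝ) ≤ A.card + B1.card + B2.card + B3.card := by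
    have : (Finset.univ : Finset (ZMod q)ˣ) ⊆ A ∪ B1 ∪ B2 ∪ B3 := by
      intro u _
      simp only [hA, hB1, hB2, hB3, Finset.mem_union, Finset.mem_filter, Finset.mem_univ, true_and]
      have e1 : (0 : ℝ) ≤ (u : ZMod q).val / (q : ℝ) := by positivity
      have e2 : (0 : ℝ) ≤ (-(u : ZMod q)⁻¹).val / (q : ℝ) := by positivity
      have e3 := hv (u : ZMod q)
      have e4 := hv (-(u : ZMod q)⁻¹)
      rcases lt_or_ge (u : ZMod q).val X with h | h
      · have e5 := hlt _ h
        rcases lt_or_ge ((-(u : ZMod q)⁻¹).val / (q : ℝ)) c with h' | h'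
        · exact Or.inl (Or.inl (Or.inr ⟨⟨e1, e5⟩, e2, h'.le⟩))
        · rcases lt_or_ge ((-(u : ZMod q)⁻¹).val / (q : ℝ)) d with h'' | h''
          · exact Or.inl (Or.inl (Or.inl ⟨h, h', h''⟩))
          · exact Or.inl (Or.inr ⟨⟨e1, e5⟩, h'', e4.le⟩)
      · exact Or.inr ⟨⟨hge _ h, e3.le⟩, e2, e4.le⟩
    have h5 := (Finset.card_le_card this).trans ((Finset.card_union_le _ _).trans
      (Nat.add_le_add_right ((Finset.card_union_le _ _).trans
        (Nat.add_le_add_right (Finset.card_union_le _ _) _)) _))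
    rw [Finset.card_univ, ZMod.card_units_eq_totient] at h5
    exact_mod_cast h5
  have e : (q.totient : ℝ) / q * (d - c) * X = q.totient * ((X / q - 0) * (d - c)) := by
    field_simp; ring
  rw [e, abs_le]
  have hε' : 0 < ε * q := by positivity
  constructor
  · nlinarith
  · linarith

/-- Joint equidistribution of `n` and `fareyNumer q n` for `n` in a window of length at most
`q`. -/
theorem abs_card_window_sub_le {c d : ℝ} (hc : 0 ≤ c) (hcd : c ≤ d) (hd : d ≤ 1)
    {ε : ℝ} (hε : 0 < ε) :
    ∀ᶠ q : ℕ in atTop, ∀ x y : ℕ, x ≤ y → y ≤ x + q →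
      |(((Finset.Ioc x y).filter fun n => n.Coprime q ∧ c ≤ fareyNumer q n / (q : ℝ) ∧
        fareyNumer q n / (q : ℝ) < d).card : ℝ) - q.totient / q * (d - c) * ((y : ℝ) - x)|
        ≤ ε * q := by
  filter_upwards [abs_card_residues_sub_le hc hcd hd (ε := ε / 4) (by positivity),
    eventually_gt_atTop 0] with q h1 hq x y hxy hyx
  classical
  have hqR : (0 : ℝ) < q := Nat.cast_pos.2 hq
  set p : ℕ → Prop := fun n => n.Coprime q ∧ c ≤ fareyNumer q n / (q : ℝ) ∧
        fareyNumer q n / (q : ℝ) < d with hp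
  set κ : ℝ := q.totient / q * (d - c) with hκ
  have hper : ∀ n, p (q + n) ↔ p n := by
    intro n
    simp [hp, fareyNumer]
  have hcount : ∀ X, ((Finset.range X).filter p).card = Nat.count p X := fun X =>
    (Nat.count_eq_card_filter_range p X).symm
  have hadd : ∀ X, Nat.count p (q + X) = Nat.count p q + Nat.count p X := by
    intro X
    rw [Nat.count_add]
    congr 1
    simp_rw [hper]
  have hmul : ∀ i X, Nat.count p (i * q + X) = i * Nat.count p q + Nat.count p X := by
    intro i X
    induction i with
    | zero => simp
    | succ i ih =>
      rw [show (i + 1) * q + X = q + (i * q + X) by ring, hadd, ih]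
      ring
  have hb : ∀ X ≤ q, |(Nat.count p X : ℝ) - κ * X| ≤ ε / 4 * q := by
    intro X hX
    rw [← hcount]
    exact h1 X hX
  have hb2 : ∀ X ≤ 2 * q, |(Nat.count p X : ℝ) - κ * X| ≤ ε / 2 * q := by
    intro X hX
    rcases le_total X q with h | h
    · refine (hb X h).trans ?_
      gcongr
      linarith
    · obtain ⟨Y, rfl⟩ := Nat.exists_eq_add_of_le h
      rw [hadd]
      have e1 := abs_le.1 (hb q le_rfl)
      have e2 := abs_le.1 (hb Y (by omega))
      push_cast
      rw [abs_le]
      constructor <;> nlinarith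
  have hfil : (((Finset.Ioc x y).filter p).card : ℝ) =
      Nat.count p (y + 1) - Nat.count p (x + 1) := by
    rw [eq_sub_iff_add_eq, ← hcount, ← hcount, ← Nat.cast_add, Nat.cast_inj,
      ← Finset.card_union_of_disjoint, ← Finset.filter_union]
    · congr 2
      ext n
      simp only [Finset.mem_union, Finset.mem_Ioc, Finset.mem_range]
      omega
    · refine Finset.disjoint_filter_filter ?_
      rw [Finset.disjoint_left]
      intro n hn
      simp only [Finset.mem_Ioc, Finset.mem_range] at hn ⊢
      omega
  have hx1 := Nat.div_add_mod (x + 1) q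
  set i := (x + 1) / q
  set r := (x + 1) % q with hr
  have hrq : r < q := Nat.mod_lt _ hq
  obtain ⟨s, hs⟩ : ∃ s, y + 1 = i * q + s := ⟨y + 1 - i * q, by
    rw [mul_comm] at hx1
    omega⟩
  have hx2 : x + 1 = i * q + r := by rw [mul_comm]; exact hx1.symm
  rw [hfil, hs, hx2, hmul, hmul]
  have e1 := abs_le.1 (hb2 r (by omega))
  have e2 := abs_le.1 (hb2 s (by omega))
  have e3 : (y : ℝ) - x = s - r := by
    have a1 : (y : ℝ) + 1 = i * q + s := by exact_mod_cast hs
    have a2 : (x : ℝ) + 1 = i * q + r := by exact_mod_cast hx2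
    linarith
  rw [e3, abs_le]
  push_cast
  constructor <;> nlinarith

/-! ### Sums over Euler's totient function -/

theorem tsum_moebius_div_sq :
    ∑' d : ℕ, (ArithmeticFunction.moebius d : ℝ) / (d : ℝ) ^ 2 = 6 / Real.pi ^ 2 := by
  have h1 := LSeries_one_mul_Lseries_moebius (s := 2) (by norm_num)
  rw [LSeries_one_eq_riemannZeta (by norm_num), riemannZeta_two] at h1
  have h2 : LSeries (fun n => (ArithmeticFunction.moebius n : ℂ)) 2 =
      ((∑' d : ℕ, (ArithmeticFunction.moebius d : ℝ) / (d : ℝ) ^ 2 : ℝ) : ℂ) := by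
    rw [LSeries, Complex.ofReal_tsum]
    refine tsum_congr fun d => ?_
    rw [LSeries.term_def]
    split_ifs with hd
    · simp [hd]
    · push_cast
      congr 1
      exact_mod_cast Complex.cpow_natCast (d : ℂ) 2
  rw [h2] at h1
  have h3 : Real.pi ^ 2 / 6 *
      (∑' d : ℕ, (ArithmeticFunction.moebius d : ℝ) / (d : ℝ) ^ 2) = 1 := by
    exact_mod_cast h1
  have hpi := Real.pi_pos
  field_simp
  field_simp at h3
  linarith

theorem totient_div_eq_sum_moebius {q : ℕ} (hq : 0 < q) :
    (q.totient : ℝ) / q =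
      ∑ x ∈ q.divisorsAntidiagonal, (ArithmeticFunction.moebius x.1 : ℝ) / x.1 := by
  have h := (ArithmeticFunction.sum_eq_iff_sum_mul_moebius_eq (R := ℝ)
    (f := fun n => (n.totient : ℝ)) (g := fun n => (n : ℝ))).1
    (fun n _ => by exact_mod_cast Nat.sum_totient n) q hq
  rw [← h, Finset.sum_div]
  refine Finset.sum_congr rfl fun x hx => ?_
  have hx1 := (Nat.mem_divisorsAntidiagonal.1 hx).1
  have h1 : (x.1 : ℝ) ≠ 0 := by
    rintro h0
    rw [Nat.cast_eq_zero.1 h0] at hx1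
    omega
  have h2 : (x.2 : ℝ) ≠ 0 := by
    rintro h0
    rw [Nat.cast_eq_zero.1 h0] at hx1
    omega
  rw [← hx1]
  push_cast
  field_simp

theorem sum_Ioc_sum_divisorsAntidiagonal_mul (a F : ℕ → ℝ) (N : ℕ) :
    ∑ q ∈ Finset.Ioc 0 N, (∑ x ∈ q.divisorsAntidiagonal, a x.1) * F q =
      ∑ d ∈ Finset.Ioc 0 N, a d * ∑ m ∈ Finset.Ioc 0 (N / d), F (d * m) := by
  trans ∑ q ∈ Finset.Ioc 0 N,
      ∑ x ∈ Finset.Ioc 0 N ×ˢ Finset.Ioc 0 N with x.1 * x.2 = q, a x.1 * F (x.1 * x.2)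
  · refine Finset.sum_congr rfl fun n hn => ?_
    simp only [Finset.mem_Ioc] at hn
    rw [Nat.divisorsAntidiagonal_eq_prod_filter_of_le hn.1.ne' hn.2, Finset.sum_mul]
    refine Finset.sum_congr rfl fun x hx => ?_
    rw [(Finset.mem_filter.1 hx).2]
  · simp_rw [Finset.sum_filter]
    rw [Finset.sum_comm, Finset.sum_product]
    refine Finset.sum_congr rfl fun d hd => ?_
    have hd0 : 0 < d := (Finset.mem_Ioc.1 hd).1
    rw [Finset.mul_sum]
    symm
    refine Finset.sum_subset_zero_on_sdiff ?_ ?_ ?_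
    · intro m hm
      simp only [Finset.mem_Ioc] at hm ⊢
      exact ⟨hm.1, hm.2.trans (Nat.div_le_self _ _)⟩
    · intro m hm
      simp only [Finset.mem_sdiff, Finset.mem_Ioc, not_and, not_le] at hm
      have h1 := hm.2 hm.1.1
      have h2 : N < d * m := by
        rw [Nat.div_lt_iff_lt_mul hd0] at h1
        linarith
      refine Finset.sum_eq_zero fun q hq => ?_
      rw [if_neg]
      have := (Finset.mem_Ioc.1 hq).2
      show ¬ d * m = q
      omega
    · intro m hm
      simp only [Finset.mem_Ioc] at hm
      rw [Finset.sum_ite_eq, if_pos]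
      rw [Finset.mem_Ioc]
      exact ⟨Nat.mul_pos hd0 hm.1, by
        have := (Nat.le_div_iff_mul_le hd0).1 hm.2
        linarith⟩

theorem abs_riemannSum_le {K : ℝ → ℝ} {B : ℝ} (hB : ∀ t ∈ Icc (0 : ℝ) 1, |K t| ≤ B) {h : ℝ}
    (hh : 0 < h) : |h * ∑ m ∈ Finset.Ioc 0 ⌊h⁻¹⌋₊, K (m * h)| ≤ B := by
  have hB0 : 0 ≤ B := (abs_nonneg _).trans (hB 0 (by simp))
  have hfl : (⌊h⁻¹⌋₊ : ℝ) * h ≤ 1 := by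
    have := Nat.floor_le (inv_pos.2 hh).le
    calc _ ≤ h⁻¹ * h := by gcongr
      _ = 1 := inv_mul_cancel₀ hh.ne'
  have h1 : |∑ m ∈ Finset.Ioc 0 ⌊h⁻¹⌋₊, K (m * h)| ≤ ⌊h⁻¹⌋₊ * B := by
    refine (Finset.abs_sum_le_sum_abs _ _).trans ?_
    have : ∀ m ∈ Finset.Ioc 0 ⌊h⁻¹⌋₊, |K (m * h)| ≤ B := by
      intro m hm
      refine hB _ ⟨by positivity, le_trans ?_ hfl⟩
      have := (Finset.mem_Ioc.1 hm).2
      gcongr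
    have h2 := Finset.sum_le_card_nsmul _ _ _ this
    simpa using h2
  rw [abs_mul, abs_of_pos hh]
  calc h * _ ≤ h * (⌊h⁻¹⌋₊ * B) := by gcongr
    _ = (⌊h⁻¹⌋₊ * h) * B := by ring
    _ ≤ 1 * B := by gcongr
    _ = B := one_mul B

theorem tendsto_riemannSum {K : ℝ → ℝ} (hK : Continuous K) :
    Tendsto (fun h : ℝ => h * ∑ m ∈ Finset.Ioc 0 ⌊h⁻¹⌋₊, K (m * h)) (𝓝[>] 0)
      (𝓝 (∫ t in (0 : ℝ)..1, K t)) := by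
  obtain ⟨B, hB⟩ := isCompact_Icc.exists_bound_of_continuousOn (hK.continuousOn (s := Icc (0 : ℝ) 1))
  have hB0 : 0 ≤ B := (norm_nonneg _).trans (hB 0 (by simp))
  have huc := isCompact_Icc.uniformContinuousOn_of_continuous (hK.continuousOn (s := Icc (0 : ℝ) 1))
  rw [Metric.uniformContinuousOn_iff] at huc
  rw [Metric.tendsto_nhds]
  intro ε hε
  obtain ⟨δ, hδ, hucδ⟩ := huc (ε / 2) (half_pos hε)
  have hev : ∀ᶠ h : ℝ in 𝓝[>] 0, h < min δ (ε / (2 * (B + 1))) :=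
    eventually_nhdsWithin_of_eventually_nhds (eventually_lt_nhds (by positivity))
  filter_upwards [hev, self_mem_nhdsWithin] with h hlt hh
  have hh : 0 < h := hh
  have hhδ : h < δ := hlt.trans_le (min_le_left _ _)
  have hhB : h * (B + 1) < ε / 2 := by
    have := (lt_div_iff₀ (by positivity)).1 (hlt.trans_le (min_le_right _ _))
    linarith
  set n := ⌊h⁻¹⌋₊ with hn
  have hfl : (n : ℝ) * h ≤ 1 := by
    have := Nat.floor_le (inv_pos.2 hh).le
    calc _ ≤ h⁻¹ * h := by gcongr
      _ = 1 := inv_mul_cancel₀ hh.ne'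
  have hfl' : 1 < (n : ℝ) * h + h := by
    have := Nat.lt_floor_add_one h⁻¹
    calc 1 = h⁻¹ * h := (inv_mul_cancel₀ hh.ne').symm
      _ < (n + 1) * h := by gcongr
      _ = _ := by ring
  have hint : ∀ a b : ℝ, IntervalIntegrable K volume a b := fun a b => hK.intervalIntegrable a b
  have hsplit := intervalIntegral.integral_add_adjacent_intervals (hint 0 (n * h)) (hint (n * h) 1)
  have hadj := intervalIntegral.sum_integral_adjacent_intervals (f := K) (μ := volume)
    (a := fun k : ℕ => (k : ℝ) * h) (n := n) (fun k _ => hint _ _)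
  simp only [Nat.cast_zero, zero_mul] at hadj
  have hsum : h * ∑ m ∈ Finset.Ioc 0 n, K (m * h) =
      ∑ k ∈ Finset.range n, h * K (((k + 1 : ℕ) : ℝ) * h) := by
    rw [Finset.mul_sum, Finset.range_eq_Ico, Finset.sum_Ico_add' (fun m : ℕ => h * K (m * h)) 0 n 1]
    rfl
  have hpiece : ∀ k ∈ Finset.range n, ‖(∫ t in ((k : ℝ) * h)..(((k + 1 : ℕ) : ℝ) * h), K t) -
      h * K (((k + 1 : ℕ) : ℝ) * h)‖ ≤ ε / 2 * h := by
    intro k hk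
    have hk1 : ((k + 1 : ℕ) : ℝ) ≤ n := by exact_mod_cast Finset.mem_range.1 hk
    have hle : ((k + 1 : ℕ) : ℝ) * h ≤ 1 := le_trans (by gcongr) hfl
    have hlen : ((k + 1 : ℕ) : ℝ) * h - k * h = h := by push_cast; ring
    have hc : h * K (((k + 1 : ℕ) : ℝ) * h) =
        ∫ t in ((k : ℝ) * h)..(((k + 1 : ℕ) : ℝ) * h), K (((k + 1 : ℕ) : ℝ) * h) := by
      rw [intervalIntegral.integral_const, hlen, smul_eq_mul]
    rw [hc, ← intervalIntegral.integral_sub (hint _ _) intervalIntegrable_const]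
    refine (intervalIntegral.norm_integral_le_of_norm_le_const (C := ε / 2) fun t ht => ?_).trans ?_
    · rw [uIoc_of_le (by linarith)] at ht
      have ht0 : 0 ≤ t := le_trans (by positivity) ht.1.le
      have := hucδ t ⟨ht0, ht.2.trans hle⟩ (((k + 1 : ℕ) : ℝ) * h) ⟨by positivity, hle⟩ (by
        rw [Real.dist_eq, abs_lt]
        constructor <;> linarith [ht.1, ht.2])
      rw [← dist_eq_norm]
      exact this.le
    · rw [hlen, abs_of_pos hh]
  have htail : ‖∫ t in ((n : ℝ) * h)..1, K t‖ ≤ B * h := by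
    refine (intervalIntegral.norm_integral_le_of_norm_le_const (C := B) fun t ht => ?_).trans ?_
    · rw [uIoc_of_le hfl] at ht
      exact hB t ⟨le_trans (by positivity) ht.1.le, ht.2⟩
    · rw [abs_of_nonneg (by linarith)]
      gcongr
      linarith
  have hmain : ‖(∑ k ∈ Finset.range n, ∫ t in ((k : ℝ) * h)..(((k + 1 : ℕ) : ℝ) * h), K t) -
      ∑ k ∈ Finset.range n, h * K (((k + 1 : ℕ) : ℝ) * h)‖ ≤ ε / 2 := by
    rw [← Finset.sum_sub_distrib]
    refine (norm_sum_le _ _).trans ((Finset.sum_le_sum hpiece).trans ?_)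
    rw [Finset.sum_const, Finset.card_range, nsmul_eq_mul]
    calc (n : ℝ) * (ε / 2 * h) = ε / 2 * (n * h) := by ring
      _ ≤ ε / 2 * 1 := by gcongr
      _ = ε / 2 := mul_one _
  rw [hadj] at hmain
  rw [dist_comm, Real.dist_eq, hsum, ← hsplit]
  rw [Real.norm_eq_abs, abs_le] at hmain htail
  rw [abs_lt]
  constructor <;> nlinarith

/-- Möbius inversion turns a sum with weights `φ(q) / q` into a series of Riemann sums. -/
theorem tendsto_sum_totient_div {K : ℝ → ℝ} (hK : Continuous K) :
    Tendsto (fun Q : ℝ => Q⁻¹ * ∑ q ∈ Finset.Ioc 0 ⌊Q⌋₊, (q.totient : ℝ) / q * K (q / Q)) atTop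
      (𝓝 (6 / Real.pi ^ 2 * ∫ t in (0 : ℝ)..1, K t)) := by
  obtain ⟨B, hB⟩ := isCompact_Icc.exists_bound_of_continuousOn (hK.continuousOn (s := Icc (0 : ℝ) 1))
  have hB0 : 0 ≤ B := (norm_nonneg _).trans (hB 0 (by simp))
  set R : ℝ → ℝ := fun h => h * ∑ m ∈ Finset.Ioc 0 ⌊h⁻¹⌋₊, K (m * h) with hR
  set f : ℝ → ℕ → ℝ := fun Q d =>
    (ArithmeticFunction.moebius d : ℝ) / (d : ℝ) ^ 2 * R (d / Q) with hf
  have hmu : ∀ d : ℕ, |(ArithmeticFunction.moebius d : ℝ)| ≤ 1 := fun d => by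
    exact_mod_cast ArithmeticFunction.abs_moebius_le_one
  have hlim : Tendsto (fun Q => ∑' d, f Q d) atTop
      (𝓝 (∑' d : ℕ, (ArithmeticFunction.moebius d : ℝ) / (d : ℝ) ^ 2 * ∫ t in (0 : ℝ)..1, K t)) := by
    refine tendsto_tsum_of_dominated_convergence (bound := fun d : ℕ => 1 / (d : ℝ) ^ 2 * B) ?_ ?_ ?_
    · exact (Real.summable_one_div_nat_pow.2 (by norm_num)).mul_right B
    · intro d
      rcases Nat.eq_zero_or_pos d with rfl | hd
      · simp [hf]
      · refine Tendsto.const_mul _ ((tendsto_riemannSum hK).comp ?_)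
        refine tendsto_nhdsWithin_iff.2 ⟨tendsto_const_nhds.div_atTop tendsto_id, ?_⟩
        filter_upwards [eventually_gt_atTop 0] with Q hQ
        exact div_pos (Nat.cast_pos.2 hd) hQ
    · filter_upwards [eventually_gt_atTop 0] with Q hQ d
      rcases Nat.eq_zero_or_pos d with rfl | hd
      · simp [hf]
      · rw [hf, norm_mul, norm_div, Real.norm_eq_abs, Real.norm_eq_abs, Real.norm_eq_abs,
          abs_of_nonneg (by positivity : (0 : ℝ) ≤ (d : ℝ) ^ 2)]
        refine mul_le_mul ?_ (abs_riemannSum_le hB (div_pos (Nat.cast_pos.2 hd) hQ))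
          (abs_nonneg _) (by positivity)
        have := hmu d
        gcongr
  rw [tsum_mul_right, tsum_moebius_div_sq] at hlim
  refine hlim.congr' ?_
  filter_upwards [eventually_gt_atTop 0] with Q hQ
  have hsupp : ∀ d ∉ Finset.Ioc 0 ⌊Q⌋₊, f Q d = 0 := by
    intro d hd
    rcases Nat.eq_zero_or_pos d with rfl | hd0
    · simp [hf]
    · have h1 : ⌊Q⌋₊ < d := by
        simp only [Finset.mem_Ioc, not_and, not_le] at hd
        exact hd hd0
      have h2 : ⌊Q / (d : ℝ)⌋₊ = 0 := by
        rw [Nat.floor_div_natCast]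
        exact Nat.div_eq_of_lt h1
      simp only [hf, hR, inv_div, h2]
      simp
  rw [tsum_eq_sum hsupp]
  have e1 : ∑ q ∈ Finset.Ioc 0 ⌊Q⌋₊, (q.totient : ℝ) / q * K (q / Q) =
      ∑ q ∈ Finset.Ioc 0 ⌊Q⌋₊, (∑ x ∈ q.divisorsAntidiagonal,
        (ArithmeticFunction.moebius x.1 : ℝ) / x.1) * K (q / Q) :=
    Finset.sum_congr rfl fun q hq => by rw [totient_div_eq_sum_moebius (Finset.mem_Ioc.1 hq).1]
  rw [e1, sum_Ioc_sum_divisorsAntidiagonal_mul (fun d => (ArithmeticFunction.moebius d : ℝ) / d)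
    (fun q => K (q / Q)), Finset.mul_sum]
  refine Finset.sum_congr rfl fun d hd => ?_
  have hd0 : (d : ℝ) ≠ 0 := Nat.cast_ne_zero.2 (Finset.mem_Ioc.1 hd).1.ne'
  simp only [hf, hR]
  rw [inv_div, Nat.floor_div_natCast]
  have e2 : ∀ m : ℕ, ((d * m : ℕ) : ℝ) / Q = m * (d / Q) := fun m => by push_cast; ring
  simp_rw [e2]
  field_simp

/-! ### Pairs of neighbouring Farey fractions -/

/-- The pairs of denominators of neighbouring Farey fractions of level `N`: coprime `q, n ≤ N` with
`q + n > N`. -/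
def fareyPairs (N : ℕ) : Finset (ℕ × ℕ) :=
  (Finset.Icc 1 N ×ˢ Finset.Icc 1 N).filter fun x => N < x.1 + x.2 ∧ x.2.Coprime x.1

/-- The left one of the two neighbouring Farey fractions with denominators `x.1` and `x.2`. -/
noncomputable def fareyLeft (x : ℕ × ℕ) : ℝ := (fareyNumer x.1 x.2 : ℝ) / x.1

/-- The length of the gap between two neighbouring Farey fractions with denominators `x.1` and
`x.2`. -/
noncomputable def fareyGap (x : ℕ × ℕ) : ℝ := 1 / ((x.1 : ℝ) * x.2)

theorem mem_fareyPairs {N : ℕ} {x : ℕ × ℕ} : x ∈ fareyPairs N ↔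
    (1 ≤ x.1 ∧ x.1 ≤ N) ∧ (1 ≤ x.2 ∧ x.2 ≤ N) ∧ N < x.1 + x.2 ∧ x.2.Coprime x.1 := by
  simp [fareyPairs, and_assoc]

theorem fareyNumer_lt {q : ℕ} (hq : 0 < q) (n : ℕ) : fareyNumer q n < q := by
  have : NeZero q := ⟨hq.ne'⟩
  exact ZMod.val_lt _

theorem exists_mul_eq_fareyNumer_mul_add_one {q n : ℕ} (hq : 0 < q) (h : n.Coprime q) :
    ∃ m : ℕ, m * q = fareyNumer q n * n + 1 := by
  have : NeZero q := ⟨hq.ne'⟩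
  have h1 : ((fareyNumer q n * n + 1 : ℕ) : ZMod q) = 0 := by
    push_cast
    rw [fareyNumer, ZMod.natCast_val, ZMod.cast_id', id_eq, neg_mul, mul_comm,
      ZMod.coe_mul_inv_eq_one n h]
    ring
  obtain ⟨m, hm⟩ := (ZMod.natCast_eq_zero_iff _ _).1 h1
  exact ⟨m, by rw [hm, mul_comm]⟩

theorem fareyNumer_eq {q n p : ℕ} (hp : p < q) (h : q ∣ p * n + 1) : fareyNumer q n = p := by
  have : NeZero q := ⟨by omega⟩
  have h1 : ((p * n + 1 : ℕ) : ZMod q) = 0 := (ZMod.natCast_eq_zero_iff _ _).2 h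
  push_cast at h1
  have hu : (n : ZMod q) * (-(p : ZMod q)) = 1 := by linear_combination -h1
  have hinv : (n : ZMod q)⁻¹ = -(p : ZMod q) := ZMod.inv_eq_of_mul_eq_one q _ _ hu
  rw [fareyNumer, hinv, neg_neg, ZMod.val_natCast_of_lt hp]

section

variable {N : ℕ} {x : ℕ × ℕ}

theorem fareyGap_pos (hx : x ∈ fareyPairs N) : 0 < fareyGap x := by
  rw [mem_fareyPairs] at hx
  have h1 : (0 : ℝ) < x.1 := Nat.cast_pos.2 hx.1.1
  have h2 : (0 : ℝ) < x.2 := Nat.cast_pos.2 hx.2.1.1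
  unfold fareyGap
  positivity

theorem fareyLeft_nonneg (x : ℕ × ℕ) : 0 ≤ fareyLeft x := by
  unfold fareyLeft
  positivity

theorem fareyLeft_lt_one (hx : x ∈ fareyPairs N) : fareyLeft x < 1 := by
  rw [mem_fareyPairs] at hx
  rw [fareyLeft, div_lt_one (Nat.cast_pos.2 hx.1.1)]
  exact_mod_cast fareyNumer_lt hx.1.1 _

/-- The right neighbour is a fraction `m / x.2` in lowest terms. -/
theorem exists_fareyLeft_add_fareyGap_eq (hx : x ∈ fareyPairs N) :
    ∃ m : ℕ, m * x.1 = fareyNumer x.1 x.2 * x.2 + 1 ∧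
      fareyLeft x + fareyGap x = (m : ℝ) / x.2 := by
  rw [mem_fareyPairs] at hx
  obtain ⟨m, hm⟩ := exists_mul_eq_fareyNumer_mul_add_one hx.1.1 hx.2.2.2
  refine ⟨m, hm, ?_⟩
  have h1 : (0 : ℝ) < x.1 := Nat.cast_pos.2 hx.1.1
  have h2 : (0 : ℝ) < x.2 := Nat.cast_pos.2 hx.2.1.1
  have hm' : (m : ℝ) * x.1 = fareyNumer x.1 x.2 * x.2 + 1 := by exact_mod_cast hm
  rw [fareyLeft, fareyGap]
  field_simp
  linarith

theorem fareyLeft_add_fareyGap_le_one (hx : x ∈ fareyPairs N) : fareyLeft x + fareyGap x ≤ 1 := by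
  obtain ⟨m, hm, he⟩ := exists_fareyLeft_add_fareyGap_eq hx
  rw [mem_fareyPairs] at hx
  rw [he, div_le_one (Nat.cast_pos.2 hx.2.1.1), Nat.cast_le]
  have h1 := fareyNumer_lt hx.1.1 x.2
  have h2 := hx.2.1.1
  refine Nat.le_of_mul_le_mul_right (c := x.1) ?_ hx.1.1
  nlinarith

/-- Strictly between neighbouring Farey fractions there is no fraction of the same level. -/
theorem not_mem_farey_gap (hx : x ∈ fareyPairs N) {a b : ℤ} (hb : 0 < b) (hbN : b ≤ N) :
    ¬ (fareyLeft x < (a : ℝ) / b ∧ (a : ℝ) / b < fareyLeft x + fareyGap x) := by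
  rintro ⟨h1, h2⟩
  obtain ⟨m, hm, he⟩ := exists_fareyLeft_add_fareyGap_eq hx
  rw [he] at h2
  rw [mem_fareyPairs] at hx
  have hq : (0 : ℝ) < x.1 := Nat.cast_pos.2 hx.1.1
  have hn : (0 : ℝ) < x.2 := Nat.cast_pos.2 hx.2.1.1
  have hbR : (0 : ℝ) < b := Int.cast_pos.2 hb
  rw [fareyLeft, div_lt_div_iff₀ hq hbR] at h1
  rw [div_lt_div_iff₀ hbR hn] at h2
  set p := fareyNumer x.1 x.2
  have h1' : (p : ℤ) * b < a * x.1 := by exact_mod_cast h1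
  have h2' : a * (x.2 : ℤ) < m * b := by exact_mod_cast h2
  have hm' : (m : ℤ) * x.1 = p * x.2 + 1 := by exact_mod_cast hm
  -- `b` is a positive combination of the two denominators
  have key : b = x.1 * (m * b - a * x.2) + x.2 * (a * x.1 - p * b) := by
    linear_combination (-b) * hm'
  have h3 : (N : ℤ) < x.1 + x.2 := by exact_mod_cast hx.2.2.1
  have h4 : (1 : ℤ) ≤ x.1 := by exact_mod_cast hx.1.1
  have h5 : (1 : ℤ) ≤ x.2 := by exact_mod_cast hx.2.1.1
  nlinarith

theorem isCoprime_fareyNumer (hx : x ∈ fareyPairs N) :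
    IsCoprime (fareyNumer x.1 x.2 : ℤ) (x.1 : ℤ) := by
  obtain ⟨m, hm, -⟩ := exists_fareyLeft_add_fareyGap_eq hx
  have hm' : (m : ℤ) * x.1 = fareyNumer x.1 x.2 * x.2 + 1 := by exact_mod_cast hm
  exact ⟨-x.2, m, by linear_combination hm'⟩

theorem fareyLeft_injOn : InjOn fareyLeft (fareyPairs N : Set (ℕ × ℕ)) := by
  have aux : ∀ x ∈ fareyPairs N, ∀ y ∈ fareyPairs N, fareyLeft x = fareyLeft y → x.1 = y.1 →
      ¬ x.2 < y.2 := by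
    intro x hx y hy h h1 hlt
    obtain ⟨m, hm, he⟩ := exists_fareyLeft_add_fareyGap_eq hy
    have hx' := mem_fareyPairs.1 hx
    have hy' := mem_fareyPairs.1 hy
    refine not_mem_farey_gap hx (a := m) (b := y.2) (by exact_mod_cast hy'.2.1.1)
      (by exact_mod_cast hy'.2.1.2) ⟨?_, ?_⟩
    · rw [h]
      push_cast
      rw [← he]
      linarith [fareyGap_pos hy]
    · push_cast
      rw [← he, ← h]
      have hq : (0 : ℝ) < y.1 := Nat.cast_pos.2 hy'.1.1
      have hn : (0 : ℝ) < x.2 := Nat.cast_pos.2 hx'.2.1.1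
      have hlt' : (x.2 : ℝ) < y.2 := Nat.cast_lt.2 hlt
      rw [fareyGap, fareyGap, h1]
      gcongr
  intro x hx y hy h
  have hx : x ∈ fareyPairs N := hx
  have hy : y ∈ fareyPairs N := hy
  have hx1 := (mem_fareyPairs.1 hx).1.1
  have hy1 := (mem_fareyPairs.1 hy).1.1
  have h1 : x.1 = y.1 := by
    have h' := h
    rw [fareyLeft, fareyLeft, div_eq_div_iff (Nat.cast_pos.2 hx1).ne' (Nat.cast_pos.2 hy1).ne']
      at h'
    have h2 : (fareyNumer x.1 x.2 : ℤ) * y.1 = fareyNumer y.1 y.2 * x.1 := by exact_mod_cast h'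
    have d1 : (x.1 : ℤ) ∣ y.1 :=
      (isCoprime_fareyNumer hx).symm.dvd_of_dvd_mul_left ⟨fareyNumer y.1 y.2, by rw [h2, mul_comm]⟩
    have d2 : (y.1 : ℤ) ∣ x.1 :=
      (isCoprime_fareyNumer hy).symm.dvd_of_dvd_mul_left ⟨fareyNumer x.1 x.2, by rw [← h2, mul_comm]⟩
    exact Nat.dvd_antisymm (Int.natCast_dvd_natCast.1 d1) (Int.natCast_dvd_natCast.1 d2)
  exact Prod.ext h1 (le_antisymm (not_lt.1 (aux y hy x hx h.symm h1.symm))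
    (not_lt.1 (aux x hx y hy h h1)))

end

theorem fareySet_eq_image (Q : ℝ) : fareySet Q = fareyLeft '' (fareyPairs ⌊Q⌋₊ : Set (ℕ × ℕ)) := by
  ext r
  constructor
  · rintro ⟨⟨h0, h1⟩, p, q, hpq, hq, hqQ, rfl⟩
    have hqR : (0 : ℝ) < q := Int.cast_pos.2 hq
    have hp0 : 0 ≤ p := by
      by_contra hneg
      have : (p : ℝ) / q < 0 := div_neg_of_neg_of_pos (Int.cast_lt_zero.2 (not_le.1 hneg)) hqR
      linarith
    have hpq1 : p < q := by
      rw [div_lt_one hqR] at h1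
      exact_mod_cast h1
    lift p to ℕ using hp0
    lift q to ℕ using hq.le
    have hpq1 : p < q := by exact_mod_cast hpq1
    have hq : 0 < q := by exact_mod_cast hq
    have hqN : q ≤ ⌊Q⌋₊ := Nat.le_floor (by exact_mod_cast hqQ)
    set N := ⌊Q⌋₊ with hN
    have : NeZero q := ⟨hq.ne'⟩
    have hcop : p.Coprime q := Nat.isCoprime_iff_coprime.1 hpq
    -- the representative of `-p⁻¹` modulo `q` in the window `(N - q, N]`
    set k := ((N : ZMod q) + (p : ZMod q)⁻¹).val with hk
    have hkq : k < q := ZMod.val_lt _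
    have hnz : ((N - k : ℕ) : ZMod q) = -(p : ZMod q)⁻¹ := by
      rw [Nat.cast_sub (by omega), hk, ZMod.natCast_val, ZMod.cast_id', id_eq]
      ring
    have hdvd : q ∣ p * (N - k) + 1 := by
      rw [← ZMod.natCast_eq_zero_iff]
      push_cast [hnz]
      rw [mul_neg, ZMod.coe_mul_inv_eq_one p hcop]
      ring
    have hcop2 : (N - k).Coprime q := by
      refine Nat.Coprime.symm (Nat.Coprime.coprime_dvd_left hdvd ?_)
      have : (p * (N - k) + 1).Coprime (N - k) := by simp
      exact this
    refine ⟨(q, N - k), ?_, ?_⟩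
    · rw [Finset.mem_coe, mem_fareyPairs]
      refine ⟨⟨hq, hqN⟩, ⟨?_, ?_⟩, ?_, hcop2⟩ <;> simp only <;> omega
    · rw [fareyLeft, fareyNumer_eq hpq1 hdvd]
      push_cast
      rfl
  · rintro ⟨x, hx, rfl⟩
    have hx : x ∈ fareyPairs ⌊Q⌋₊ := hx
    refine ⟨⟨fareyLeft_nonneg x, fareyLeft_lt_one hx⟩, fareyNumer x.1 x.2, x.1,
      isCoprime_fareyNumer hx, ?_, ?_, ?_⟩
    · exact_mod_cast (mem_fareyPairs.1 hx).1.1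
    · have := (mem_fareyPairs.1 hx).1
      have h2 := (Nat.le_floor_iff' (by omega)).1 this.2
      exact_mod_cast h2
    · rw [fareyLeft]
      push_cast
      rfl

theorem fareyLeft_add_fareyGap_mem {Q : ℝ} {x : ℕ × ℕ} (hx : x ∈ fareyPairs ⌊Q⌋₊) :
    fareyLeft x + fareyGap x ∈ fareySet Q ∨ fareyLeft x + fareyGap x = 1 := by
  rcases (fareyLeft_add_fareyGap_le_one hx).lt_or_eq with h | h
  · left
    obtain ⟨m, hm, he⟩ := exists_fareyLeft_add_fareyGap_eq hx
    have hx' := mem_fareyPairs.1 hx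
    refine ⟨⟨add_nonneg (fareyLeft_nonneg x) (fareyGap_pos hx).le, h⟩, m, x.2, ?_, ?_, ?_, ?_⟩
    · have hm' : (m : ℤ) * x.1 = fareyNumer x.1 x.2 * x.2 + 1 := by exact_mod_cast hm
      exact ⟨x.1, -fareyNumer x.1 x.2, by linear_combination hm'⟩
    · exact_mod_cast hx'.2.1.1
    · have h2 := (Nat.le_floor_iff' (by omega)).1 hx'.2.1.2
      exact_mod_cast h2
    · rw [he]
      push_cast
      rfl
  · exact Or.inr h

theorem fareyNext_fareyLeft {Q : ℝ} {x : ℕ × ℕ} (hx : x ∈ fareyPairs ⌊Q⌋₊) :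
    fareyNext Q (fareyLeft x) = fareyLeft x + fareyGap x := by
  refine IsLeast.csInf_eq ⟨⟨by linarith [fareyGap_pos hx], fareyLeft_add_fareyGap_mem hx⟩, ?_⟩
  rintro r ⟨hr, hr'⟩
  by_contra hlt
  rw [not_le] at hlt
  rcases hr' with ⟨-, p, q, -, hq, hqQ, rfl⟩ | rfl
  · refine not_mem_farey_gap hx hq ?_ ⟨hr, hlt⟩
    lift q to ℕ using hq.le
    exact_mod_cast Nat.le_floor (by exact_mod_cast hqQ)
  · have := fareyLeft_add_fareyGap_le_one hx
    linarith

theorem fareyGapFreq_eq (Q s : ℝ) : fareyGapFreq Q s =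
    (((fareyPairs ⌊Q⌋₊).filter fun x => s / fareySigma Q < fareyGap x).card : ℝ) /
      (fareyPairs ⌊Q⌋₊).card := by
  unfold fareyGapFreq
  congr 2
  · have : {r : ℝ | r ∈ fareySet Q ∧ s / fareySigma Q < fareyNext Q r - r} = fareyLeft ''
        (((fareyPairs ⌊Q⌋₊).filter fun x => s / fareySigma Q < fareyGap x :
          Finset (ℕ × ℕ)) : Set (ℕ × ℕ)) := by
      ext r
      rw [fareySet_eq_image]
      constructor
      · rintro ⟨⟨x, hx, rfl⟩, h⟩
        rw [fareyNext_fareyLeft hx] at h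
        exact ⟨x, Finset.mem_coe.2 (Finset.mem_filter.2 ⟨hx, by linarith⟩), rfl⟩
      · rintro ⟨x, hx, rfl⟩
        obtain ⟨hx, h⟩ := Finset.mem_filter.1 (Finset.mem_coe.1 hx)
        refine ⟨⟨x, hx, rfl⟩, ?_⟩
        rw [fareyNext_fareyLeft hx]
        linarith
    rw [this, InjOn.ncard_image, ncard_coe_finset]
    exact fareyLeft_injOn.mono (Finset.coe_subset.2 (Finset.filter_subset _ _))
  · rw [fareySet_eq_image, fareyLeft_injOn.ncard_image, ncard_coe_finset]

theorem exists_mem_farey_gap {Q : ℝ} (hQ : 1 ≤ Q) {t : ℝ} (ht0 : 0 ≤ t) (ht1 : t < 1) :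
    ∃ x ∈ fareyPairs ⌊Q⌋₊, fareyLeft x ≤ t ∧ t < fareyLeft x + fareyGap x := by
  have hN : 1 ≤ ⌊Q⌋₊ := Nat.le_floor (by exact_mod_cast hQ)
  have hne : ((fareyPairs ⌊Q⌋₊).filter fun x => fareyLeft x ≤ t).Nonempty := by
    refine ⟨(1, ⌊Q⌋₊), Finset.mem_filter.2 ⟨mem_fareyPairs.2 ⟨⟨le_rfl, hN⟩, ⟨hN, le_rfl⟩, ?_, ?_⟩, ?_⟩⟩
    · simp only; omega
    · simp
    · have : fareyNumer 1 ⌊Q⌋₊ = 0 := Nat.lt_one_iff.1 (fareyNumer_lt one_pos _)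
      simpa [fareyLeft, this] using ht0
  obtain ⟨x, hx, hmax⟩ := Finset.exists_max_image _ fareyLeft hne
  obtain ⟨hx, hxt⟩ := Finset.mem_filter.1 hx
  refine ⟨x, hx, hxt, ?_⟩
  by_contra hle
  rw [not_lt] at hle
  rcases fareyLeft_add_fareyGap_mem hx with h | h
  · rw [fareySet_eq_image] at h
    obtain ⟨y, hy, he⟩ := h
    have := hmax y (Finset.mem_filter.2 ⟨hy, by rw [he]; exact hle⟩)
    linarith [fareyGap_pos hx]
  · linarith

theorem fareyGap_le {Q : ℝ} (hQ : 1 ≤ Q) {x : ℕ × ℕ} (hx : x ∈ fareyPairs ⌊Q⌋₊) :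
    fareyGap x ≤ 2 / Q := by
  have hx' := mem_fareyPairs.1 hx
  have h1 : (1 : ℝ) ≤ x.1 := by exact_mod_cast hx'.1.1
  have h2 : (1 : ℝ) ≤ x.2 := by exact_mod_cast hx'.2.1.1
  have h3 : Q < x.1 + x.2 := by
    have a1 := Nat.lt_floor_add_one Q
    have a2 : (⌊Q⌋₊ : ℝ) + 1 ≤ x.1 + x.2 := by exact_mod_cast hx'.2.2.1
    linarith
  rw [fareyGap, div_le_div_iff₀ (by positivity) (by linarith)]
  nlinarith

/-! ### The smallest denominator and the gaps between Farey fractions -/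

theorem lt_qMin_iff {x δ Q : ℝ} (hδ : 0 < δ) : Q < qMin x δ ↔
    ∀ (a : ℤ) (b : ℕ), 0 < b → (b : ℝ) ≤ Q → (a : ℝ) / b ∉ Ioo (x - δ / 2) (x + δ / 2) := by
  constructor
  · intro h a b hb hbQ hmem
    have h1 : qMin x δ ≤ b := Nat.sInf_le ⟨hb, a, hmem⟩
    have h2 : (qMin x δ : ℝ) ≤ b := Nat.cast_le.2 h1
    linarith
  · intro h
    obtain ⟨r, hr1, hr2⟩ := exists_rat_btwn (by linarith : x - δ / 2 < x + δ / 2)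
    have hne : {q : ℕ | 0 < q ∧ ∃ p : ℤ, (p : ℝ) / (q : ℝ) ∈ Ioo (x - δ / 2) (x + δ / 2)}.Nonempty :=
      ⟨r.den, r.den_pos, r.num, by rw [← Rat.cast_def]; exact ⟨hr1, hr2⟩⟩
    obtain ⟨hq, p, hp⟩ := Nat.sInf_mem hne
    by_contra hle
    exact h p _ hq (not_lt.1 hle) hp

/-- Within a Farey gap, the points `t` with `qMin t δ > Q` are those at distance at least `δ / 2`
from both ends of the gap. -/
theorem lt_qMin_iff_of_mem_gap {Q δ t : ℝ} (hδ : 0 < δ) {x : ℕ × ℕ}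
    (hx : x ∈ fareyPairs ⌊Q⌋₊) (h1 : fareyLeft x ≤ t) (h2 : t < fareyLeft x + fareyGap x) :
    Q < qMin t δ ↔ t ∈ Icc (fareyLeft x + δ / 2) (fareyLeft x + fareyGap x - δ / 2) := by
  rw [lt_qMin_iff hδ]
  have hx' := mem_fareyPairs.1 hx
  constructor
  · intro h
    constructor
    · have := h (fareyNumer x.1 x.2) x.1 hx'.1.1 ((Nat.le_floor_iff' (by omega)).1 hx'.1.2)
      rw [Int.cast_natCast, show (fareyNumer x.1 x.2 : ℝ) / x.1 = fareyLeft x from rfl, mem_Ioo,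
        not_and_or] at this
      rcases this with h' | h' <;> linarith
    · obtain ⟨m, -, he⟩ := exists_fareyLeft_add_fareyGap_eq hx
      have := h m x.2 hx'.2.1.1 ((Nat.le_floor_iff' (by omega)).1 hx'.2.1.2)
      rw [Int.cast_natCast, ← he, mem_Ioo, not_and_or] at this
      rcases this with h' | h' <;> linarith
  · rintro ⟨h3, h4⟩ a b hb hbQ ⟨h5, h6⟩
    refine not_mem_farey_gap hx (a := a) (b := b) (by exact_mod_cast hb)
      (by exact_mod_cast Nat.le_floor hbQ) ⟨?_, ?_⟩
    · push_cast; linarith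
    · push_cast; linarith

/-! ### Counting Farey gaps of a given size -/

/-- For `0 ≤ s` and `0 ≤ t ≤ 1` the length of the set of all `y ∈ (1 - t, 1]` with `s t y < 1`. -/
noncomputable def hallKernel (s t : ℝ) : ℝ := max 0 (t - 1 + (max (s * t) 1)⁻¹)

/-- The area of the part of the triangle `x, y ≤ 1 < x + y` where `s x y < 1`. -/
noncomputable def hallArea (s : ℝ) : ℝ := ∫ t in (0 : ℝ)..1, hallKernel s t

theorem continuous_hallKernel (s : ℝ) : Continuous (hallKernel s) := by
  unfold hallKernel
  have h : ∀ t : ℝ, max (s * t) 1 ≠ 0 := fun t => (lt_max_of_lt_right one_pos).ne'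
  fun_prop (disch := exact h _)

theorem hallKernel_nonneg (s t : ℝ) : 0 ≤ hallKernel s t := le_max_left _ _

theorem hallArea_nonneg (s : ℝ) : 0 ≤ hallArea s :=
  intervalIntegral.integral_nonneg zero_le_one fun t _ => hallKernel_nonneg s t

theorem hallArea_antitone : Antitone hallArea := by
  intro s s' hs
  refine intervalIntegral.integral_mono_on zero_le_one
    ((continuous_hallKernel _).intervalIntegrable _ _)
    ((continuous_hallKernel _).intervalIntegrable _ _) fun t ht => ?_
  refine max_le_max le_rfl (add_le_add le_rfl ?_)
  refine inv_anti₀ (lt_max_of_lt_right one_pos) (max_le_max ?_ le_rfl)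
  exact mul_le_mul_of_nonneg_right hs ht.1

theorem exists_threshold {P : ℕ → Prop} (hP : ∀ m n, m ≤ n → P n → P m) {A B : ℕ} (hAB : A ≤ B) :
    ∃ y, A ≤ y ∧ y ≤ B ∧ (∀ n ∈ Finset.Ioc A B, P n ↔ n ≤ y) := by
  induction B, hAB using Nat.le_induction with
  | base => exact ⟨A, le_rfl, le_rfl, by simp⟩
  | succ B hAB ih =>
    by_cases h : P (B + 1)
    · refine ⟨B + 1, by omega, le_rfl, fun n hn => ?_⟩
      have := (Finset.mem_Ioc.1 hn).2
      exact ⟨fun _ => this, fun _ => hP _ _ this h⟩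
    · obtain ⟨y, h1, h2, h3⟩ := ih
      refine ⟨y, h1, by omega, fun n hn => ?_⟩
      have hn' := Finset.mem_Ioc.1 hn
      rcases Nat.lt_or_ge B n with h4 | h4
      · have : n = B + 1 := by omega
        subst this
        exact ⟨fun h' => absurd h' h, fun h' => by omega⟩
      · exact h3 n (Finset.mem_Ioc.2 ⟨hn'.1, h4⟩)

/-- For fixed `q`, the denominators `n` of right neighbours that are counted fill a window
`(⌊Q⌋ - q, y]`, whose length is `Q * hallKernel s (q / Q)` up to a bounded error. -/
theorem exists_threshold_hallKernel {s Q : ℝ} (hs : 0 ≤ s) (hQ : 1 ≤ Q) {q : ℕ}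
    (hqN : q ≤ ⌊Q⌋₊) :
    ∃ y, ⌊Q⌋₊ - q ≤ y ∧ y ≤ ⌊Q⌋₊ ∧
      (∀ n ∈ Finset.Ioc (⌊Q⌋₊ - q) ⌊Q⌋₊, s * ((q : ℝ) * n) < Q ^ 2 ↔ n ≤ y) ∧
      |((y : ℝ) - ((⌊Q⌋₊ - q : ℕ) : ℝ)) - Q * hallKernel s (q / Q)| ≤ 2 := by
  have hQ0 : 0 < Q := by linarith
  obtain ⟨y, h1, h2, h3⟩ := exists_threshold (P := fun n : ℕ => s * ((q : ℝ) * n) < Q ^ 2)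
    (fun m n hmn h => lt_of_le_of_lt (by gcongr) h) (Nat.sub_le ⌊Q⌋₊ q)
  refine ⟨y, h1, h2, h3, ?_⟩
  set N := ⌊Q⌋₊ with hN
  have hNQ : (N : ℝ) ≤ Q := Nat.floor_le hQ0.le
  have hNQ' : Q < N + 1 := Nat.lt_floor_add_one Q
  have hyN : (y : ℝ) ≤ N := Nat.cast_le.2 h2
  have hAy : ((N - q : ℕ) : ℝ) ≤ y := Nat.cast_le.2 h1
  rw [Nat.cast_sub hqN] at hAy ⊢
  set μ : ℝ := max (s * (q / Q)) 1 with hμ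
  have hμ0 : 0 < μ := lt_max_of_lt_right one_pos
  have hμ1 : 1 ≤ μ := le_max_right _ _
  have hK : Q * hallKernel s (q / Q) = max 0 (q - Q + Q / μ) := by
    rw [hallKernel, mul_max_of_nonneg _ _ hQ0.le, mul_zero]
    congr 1
    rw [← hμ]
    field_simp
  have hYQ : Q / μ ≤ Q := div_le_self hQ0.le hμ1
  rw [hK, abs_le]
  constructor
  · rcases le_total (q - Q + Q / μ) 0 with h | h
    · rw [max_eq_left h]; linarith
    · rw [max_eq_right h]
      rcases h2.lt_or_eq with hlt | heq
      · have hP : ¬ s * ((q : ℝ) * ((y + 1 : ℕ) : ℝ)) < Q ^ 2 := by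
          rw [h3 (y + 1) (Finset.mem_Ioc.2 ⟨by omega, hlt⟩)]
          omega
        rw [not_lt] at hP
        push_cast at hP
        have h4 : Q ≤ μ * (y + 1) := by
          have : Q ≤ s * (q / Q) * (y + 1) := by
            rw [← mul_le_mul_iff_of_pos_left hQ0]
            calc Q * Q = Q ^ 2 := (sq Q).symm
              _ ≤ _ := hP
              _ = _ := by field_simp
          refine this.trans ?_
          gcongr
          exact le_max_left _ _
        have h5 : Q / μ ≤ y + 1 := by rw [div_le_iff₀ hμ0]; linarith
        linarith
      · rw [heq]; linarith
  · rcases h1.lt_or_eq with hlt | heq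
    · have hP : s * ((q : ℝ) * y) < Q ^ 2 := (h3 y (Finset.mem_Ioc.2 ⟨hlt, h2⟩)).2 le_rfl
      have h4 : y * μ ≤ Q := by
        rw [hμ, mul_max_of_nonneg _ _ (Nat.cast_nonneg _), mul_one]
        refine max_le ?_ (hyN.trans hNQ)
        rw [← mul_le_mul_iff_of_pos_left hQ0]
        calc Q * (y * (s * (q / Q))) = s * (q * y) := by field_simp
          _ ≤ Q ^ 2 := hP.le
          _ = _ := sq Q
      have h5 : y ≤ Q / μ := by rw [le_div_iff₀ hμ0]; exact h4
      have := le_max_right 0 (q - Q + Q / μ)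
      linarith
    · have h6 : (y : ℝ) = N - q := by rw [← heq, Nat.cast_sub hqN]
      have := le_max_left 0 (q - Q + Q / μ)
      linarith

/-- The number of neighbouring Farey fractions whose left member is in `[a, b)` and whose
denominators `q, n` satisfy `s q n < Q²`. -/
noncomputable def fareyCount (a b s Q : ℝ) : ℕ :=
  ((fareyPairs ⌊Q⌋₊).filter fun x => (a ≤ fareyLeft x ∧ fareyLeft x < b) ∧
    s * ((x.1 : ℝ) * x.2) < Q ^ 2).card

theorem fareyCount_eq_sum (a b s Q : ℝ) : fareyCount a b s Q =
    ∑ q ∈ Finset.Ioc 0 ⌊Q⌋₊, ((Finset.Ioc (⌊Q⌋₊ - q) ⌊Q⌋₊).filter fun n : ℕ =>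
      (n.Coprime q ∧ a ≤ fareyNumer q n / (q : ℝ) ∧ fareyNumer q n / (q : ℝ) < b) ∧
        s * ((q : ℝ) * n) < Q ^ 2).card := by
  rw [fareyCount, ← Finset.card_sigma]
  refine Finset.card_bij (fun x _ => ⟨x.1, x.2⟩) ?_ ?_ ?_
  · intro x hx
    rw [Finset.mem_filter, mem_fareyPairs] at hx
    simp only [Finset.mem_sigma, Finset.mem_filter, Finset.mem_Ioc]
    exact ⟨by omega, by omega, ⟨hx.1.2.2.2, hx.2.1⟩, hx.2.2⟩
  · intro x _ y _ h
    simp only [Sigma.mk.injEq, heq_eq_eq] at h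
    exact Prod.ext h.1 h.2
  · rintro ⟨q, n⟩ h
    simp only [Finset.mem_sigma, Finset.mem_filter, Finset.mem_Ioc] at h
    refine ⟨(q, n), ?_, rfl⟩
    rw [Finset.mem_filter, mem_fareyPairs]
    exact ⟨⟨by omega, by omega, by omega, h.2.2.1.1⟩, h.2.2.1.2, h.2.2.2⟩

/-- Joint equidistribution of the left end points and the sizes of Farey gaps. -/
theorem tendsto_fareyCount {a b s : ℝ} (ha : 0 ≤ a) (hab : a ≤ b) (hb : b ≤ 1) (hs : 0 ≤ s) :
    Tendsto (fun Q : ℝ => (fareyCount a b s Q : ℝ) / Q ^ 2) atTop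
      (𝓝 (6 / Real.pi ^ 2 * (b - a) * hallArea s)) := by
  have hmain := (tendsto_sum_totient_div (continuous_hallKernel s)).const_mul (b - a)
  have herr : Tendsto (fun Q : ℝ => (fareyCount a b s Q : ℝ) / Q ^ 2 -
      (b - a) * (Q⁻¹ * ∑ q ∈ Finset.Ioc 0 ⌊Q⌋₊, (q.totient : ℝ) / q * hallKernel s (q / Q))) atTop
      (𝓝 0) := by
    rw [Metric.tendsto_nhds]
    intro ε hε
    obtain ⟨q₀, hq₀⟩ := eventually_atTop.1
      (abs_card_window_sub_le ha hab hb (ε := ε / 4) (by positivity))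
    filter_upwards [eventually_ge_atTop 1, eventually_gt_atTop (4 * (q₀ + 2 : ℝ) / ε)]
      with Q hQ hQε
    have hQ0 : 0 < Q := by linarith
    have hNQ : (⌊Q⌋₊ : ℝ) ≤ Q := Nat.floor_le hQ0.le
    -- the trivial bound covers `q < q₀`, equidistribution covers `q ≥ q₀`
    have hterm : ∀ q ∈ Finset.Ioc 0 ⌊Q⌋₊,
        |(((Finset.Ioc (⌊Q⌋₊ - q) ⌊Q⌋₊).filter fun n : ℕ =>
          (n.Coprime q ∧ a ≤ fareyNumer q n / (q : ℝ) ∧ fareyNumer q n / (q : ℝ) < b) ∧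
          s * ((q : ℝ) * n) < Q ^ 2).card : ℝ) -
          (b - a) * (Q * ((q.totient : ℝ) / q * hallKernel s (q / Q)))| ≤
        q₀ + ε / 4 * Q + 2 := by
      intro q hq
      obtain ⟨hq0, hqN⟩ := Finset.mem_Ioc.1 hq
      have hqR : (0 : ℝ) < q := Nat.cast_pos.2 hq0
      obtain ⟨y, h1, h2, h3, h4⟩ := exists_threshold_hallKernel hs hQ hqN
      have hfil : ((Finset.Ioc (⌊Q⌋₊ - q) ⌊Q⌋₊).filter fun n : ℕ =>
          (n.Coprime q ∧ a ≤ fareyNumer q n / (q : ℝ) ∧ fareyNumer q n / (q : ℝ) < b) ∧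
          s * ((q : ℝ) * n) < Q ^ 2) = (Finset.Ioc (⌊Q⌋₊ - q) y).filter fun n : ℕ =>
          (n.Coprime q ∧ a ≤ fareyNumer q n / (q : ℝ) ∧ fareyNumer q n / (q : ℝ) < b) := by
        ext n
        simp only [Finset.mem_filter, Finset.mem_Ioc]
        constructor
        · rintro ⟨h5, h6, h7⟩
          exact ⟨⟨h5.1, (h3 n (Finset.mem_Ioc.2 h5)).1 h7⟩, h6⟩
        · rintro ⟨h5, h6⟩
          have h8 : _ ∧ _ := ⟨h5.1, h5.2.trans h2⟩
          exact ⟨h8, h6, (h3 n (Finset.mem_Ioc.2 h8)).2 h5.2⟩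
      rw [hfil]
      set C := (Finset.Ioc (⌊Q⌋₊ - q) y).filter fun n : ℕ =>
          (n.Coprime q ∧ a ≤ fareyNumer q n / (q : ℝ) ∧ fareyNumer q n / (q : ℝ) < b) with hC
      set κ : ℝ := (q.totient : ℝ) / q * (b - a) with hκ
      have hφ : (q.totient : ℝ) / q ≤ 1 :=
        (div_le_one hqR).2 (Nat.cast_le.2 (Nat.totient_le q))
      have hκ0 : 0 ≤ κ := mul_nonneg (by positivity) (by linarith)
      have hκ1 : κ ≤ 1 := mul_le_one₀ hφ (by linarith) (by linarith)
      have hyl : (y : ℝ) - ((⌊Q⌋₊ - q : ℕ) : ℝ) ≤ q := by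
        have : y ≤ (⌊Q⌋₊ - q) + q := by omega
        have : (y : ℝ) ≤ ((⌊Q⌋₊ - q : ℕ) : ℝ) + q := by exact_mod_cast this
        linarith
      have hyl0 : 0 ≤ (y : ℝ) - ((⌊Q⌋₊ - q : ℕ) : ℝ) := by
        have : ((⌊Q⌋₊ - q : ℕ) : ℝ) ≤ y := Nat.cast_le.2 h1
        linarith
      have hfirst : |(C.card : ℝ) - κ * ((y : ℝ) - ((⌊Q⌋₊ - q : ℕ) : ℝ))| ≤ q₀ + ε / 4 * Q := by
        rcases Nat.lt_or_ge q q₀ with h | h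
        · have hq' : (q : ℝ) ≤ q₀ := Nat.cast_le.2 h.le
          have hCc : (C.card : ℝ) ≤ q := by
            have := Finset.card_filter_le (Finset.Ioc (⌊Q⌋₊ - q) y) (fun n : ℕ =>
              (n.Coprime q ∧ a ≤ fareyNumer q n / (q : ℝ) ∧ fareyNumer q n / (q : ℝ) < b))
            rw [Nat.card_Ioc] at this
            exact Nat.cast_le.2 (this.trans (by omega))
          have hκy : κ * ((y : ℝ) - ((⌊Q⌋₊ - q : ℕ) : ℝ)) ≤ q :=
            (mul_le_mul hκ1 hyl hyl0 zero_le_one).trans_eq (one_mul _)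
          have hκy0 : 0 ≤ κ * ((y : ℝ) - ((⌊Q⌋₊ - q : ℕ) : ℝ)) := mul_nonneg hκ0 hyl0
          have hC0 : (0 : ℝ) ≤ C.card := Nat.cast_nonneg _
          have : 0 ≤ ε / 4 * Q := by positivity
          rw [abs_le]
          constructor <;> linarith
        · have := hq₀ q h (⌊Q⌋₊ - q) y h1 (by omega)
          refine this.trans ?_
          have hq' : (q : ℝ) ≤ Q := (Nat.cast_le.2 hqN).trans hNQ
          calc ε / 4 * q ≤ ε / 4 * Q := by gcongr
            _ ≤ q₀ + ε / 4 * Q := by linarith [Nat.cast_nonneg (α := ℝ) q₀]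
      have hsecond : |κ * ((y : ℝ) - ((⌊Q⌋₊ - q : ℕ) : ℝ)) -
          (b - a) * (Q * ((q.totient : ℝ) / q * hallKernel s (q / Q)))| ≤ 2 := by
        have e : κ * ((y : ℝ) - ((⌊Q⌋₊ - q : ℕ) : ℝ)) -
          (b - a) * (Q * ((q.totient : ℝ) / q * hallKernel s (q / Q))) =
          κ * (((y : ℝ) - ((⌊Q⌋₊ - q : ℕ) : ℝ)) - Q * hallKernel s (q / Q)) := by
          rw [hκ]; ring
        rw [e, abs_mul, abs_of_nonneg hκ0]
        exact (mul_le_mul hκ1 h4 (abs_nonneg _) zero_le_one).trans_eq (one_mul _)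
      calc _ ≤ _ := abs_sub_le _ (κ * ((y : ℝ) - ((⌊Q⌋₊ - q : ℕ) : ℝ))) _
        _ ≤ _ := add_le_add hfirst hsecond
    have hsum := (Finset.abs_sum_le_sum_abs _ _).trans (Finset.sum_le_card_nsmul _ _ _ hterm)
    rw [Finset.sum_sub_distrib, ← Finset.mul_sum, ← Finset.mul_sum, ← Nat.cast_sum,
      ← fareyCount_eq_sum, Nat.card_Ioc, tsub_zero, nsmul_eq_mul] at hsum
    set T := ∑ q ∈ Finset.Ioc 0 ⌊Q⌋₊, (q.totient : ℝ) / q * hallKernel s (q / Q) with hT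
    have e : (fareyCount a b s Q : ℝ) / Q ^ 2 - (b - a) * (Q⁻¹ * T) =
        ((fareyCount a b s Q : ℝ) - (b - a) * (Q * T)) / Q ^ 2 := by
      field_simp
    rw [dist_zero_right, Real.norm_eq_abs, e, abs_div, abs_of_pos (by positivity : 0 < Q ^ 2),
      div_lt_iff₀ (by positivity)]
    have h5 := (div_lt_iff₀ hε).1 hQε
    calc _ ≤ _ := hsum
      _ ≤ Q * (q₀ + ε / 4 * Q + 2) := by gcongr
      _ < ε * Q ^ 2 := by nlinarith
  have hfin := herr.add hmain
  simp only [sub_add_cancel, zero_add] at hfin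
  convert hfin using 2
  rw [hallArea]
  ring

/-- One of two neighbouring denominators exceeds `Q / 2`, so that the other one is small when the
product is. -/
theorem fareyCount_le {a b s Q : ℝ} (hs : 0 < s) (hQ : 0 < Q) :
    (fareyCount a b s Q : ℝ) ≤ 8 / s ^ 2 * Q ^ 2 := by
  set N := ⌊Q⌋₊ with hN
  set m := ⌊2 * Q / s⌋₊ with hm
  have hsub : ((fareyPairs N).filter fun x => (a ≤ fareyLeft x ∧ fareyLeft x < b) ∧
      s * ((x.1 : ℝ) * x.2) < Q ^ 2) ⊆
      ((fareyPairs N).filter fun x => x.2 ≤ m) ∪ ((fareyPairs N).filter fun x => x.1 ≤ m) := by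
    intro x hx
    obtain ⟨hx, -, h⟩ := Finset.mem_filter.1 hx
    rw [Finset.mem_union, Finset.mem_filter, Finset.mem_filter]
    have hx' := mem_fareyPairs.1 hx
    have h3 : Q < x.1 + x.2 := by
      have a1 := Nat.lt_floor_add_one Q
      have a2 : (⌊Q⌋₊ : ℝ) + 1 ≤ x.1 + x.2 := by exact_mod_cast hx'.2.2.1
      linarith
    have h1 : (0 : ℝ) < x.1 := Nat.cast_pos.2 hx'.1.1
    have h2 : (0 : ℝ) < x.2 := Nat.cast_pos.2 hx'.2.1.1
    rcases le_total (x.1 : ℝ) x.2 with hle | hle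
    · refine Or.inr ⟨hx, Nat.le_floor ?_⟩
      rw [le_div_iff₀ hs]
      by_contra hlt
      rw [not_le] at hlt
      nlinarith [mul_pos hs h1]
    · refine Or.inl ⟨hx, Nat.le_floor ?_⟩
      rw [le_div_iff₀ hs]
      by_contra hlt
      rw [not_le] at hlt
      nlinarith [mul_pos hs h2]
  have c1 : ((fareyPairs N).filter fun x => x.2 ≤ m).card ≤ m * m := by
    have hcard : (Finset.range m ×ˢ Finset.range m).card = m * m := by simp
    rw [← hcard]
    refine Finset.card_le_card_of_injOn (fun x => (x.2 - 1, N - x.1)) ?_ ?_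
    · intro x hx
      simp only [Finset.coe_filter, mem_ofPred_eq, mem_fareyPairs] at hx
      simp only [Finset.coe_product, Finset.coe_range, mem_prod, mem_Iio]
      omega
    · intro x hx y hy h
      simp only [Finset.coe_filter, mem_ofPred_eq, mem_fareyPairs] at hx hy
      simp only [Prod.mk.injEq] at h
      refine Prod.ext ?_ ?_ <;> omega
  have c2 : ((fareyPairs N).filter fun x => x.1 ≤ m).card ≤ m * m := by
    have hcard : (Finset.range m ×ˢ Finset.range m).card = m * m := by simp
    rw [← hcard]
    refine Finset.card_le_card_of_injOn (fun x => (x.1 - 1, N - x.2)) ?_ ?_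
    · intro x hx
      simp only [Finset.coe_filter, mem_ofPred_eq, mem_fareyPairs] at hx
      simp only [Finset.coe_product, Finset.coe_range, mem_prod, mem_Iio]
      omega
    · intro x hx y hy h
      simp only [Finset.coe_filter, mem_ofPred_eq, mem_fareyPairs] at hx hy
      simp only [Prod.mk.injEq] at h
      refine Prod.ext ?_ ?_ <;> omega
  have hc : fareyCount a b s Q ≤ m * m + m * m :=
    (Finset.card_le_card hsub).trans ((Finset.card_union_le _ _).trans (add_le_add c1 c2))
  have hc' : (fareyCount a b s Q : ℝ) ≤ m * m + m * m := by exact_mod_cast hc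
  have hmle : (m : ℝ) ≤ 2 * Q / s := Nat.floor_le (by positivity)
  calc (fareyCount a b s Q : ℝ) ≤ m * m + m * m := hc'
    _ ≤ (2 * Q / s) * (2 * Q / s) + (2 * Q / s) * (2 * Q / s) := by gcongr
    _ = 8 / s ^ 2 * Q ^ 2 := by field_simp; ring

theorem hallArea_of_le_one {σ : ℝ} (hσ : σ ≤ 1) : hallArea σ = 1 / 2 := by
  have : hallArea σ = ∫ t in (0 : ℝ)..1, t := by
    refine intervalIntegral.integral_congr fun t ht => ?_
    rw [uIcc_of_le zero_le_one] at ht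
    have h : σ * t ≤ 1 := by nlinarith [ht.1, ht.2]
    simp [hallKernel, ht.1, max_eq_right h]
  rw [this, integral_id]
  norm_num

theorem fareyCount_zero_one (s Q : ℝ) : fareyCount 0 1 s Q =
    ((fareyPairs ⌊Q⌋₊).filter fun x => s * ((x.1 : ℝ) * x.2) < Q ^ 2).card := by
  unfold fareyCount
  congr 1
  refine Finset.filter_congr fun x hx => ?_
  simp [fareyLeft_nonneg, fareyLeft_lt_one hx]

theorem mul_lt_sq_iff {N : ℕ} {x : ℕ × ℕ} (hx : x ∈ fareyPairs N) {s Q : ℝ} (hQ : 0 < Q) :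
    s * ((x.1 : ℝ) * x.2) < Q ^ 2 ↔ s / Q ^ 2 < fareyGap x := by
  have hx' := mem_fareyPairs.1 hx
  have h1 : (0 : ℝ) < x.1 := Nat.cast_pos.2 hx'.1.1
  have h2 : (0 : ℝ) < x.2 := Nat.cast_pos.2 hx'.2.1.1
  rw [fareyGap, div_lt_div_iff₀ (by positivity) (by positivity), one_mul]

/-- The Hall distribution, as a ratio of two instances of `tendsto_fareyCount`: the denominator is
the case `s = 0`, where every gap is counted. -/
theorem tendsto_fareyGapFreq {s : ℝ} (hs : 0 ≤ s) :
    Tendsto (fun Q : ℝ => fareyGapFreq Q s) atTop (𝓝 (2 * hallArea (Real.pi ^ 2 / 3 * s))) := by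
  have hpi := Real.pi_pos
  have h1 := tendsto_fareyCount le_rfl zero_le_one le_rfl
    (by positivity : 0 ≤ Real.pi ^ 2 / 3 * s)
  have h0 := tendsto_fareyCount le_rfl zero_le_one le_rfl (le_refl (0 : ℝ))
  have hlim := h1.div h0 (by rw [hallArea_of_le_one zero_le_one]; positivity)
  have e : 6 / Real.pi ^ 2 * (1 - 0) * hallArea (Real.pi ^ 2 / 3 * s) /
      (6 / Real.pi ^ 2 * (1 - 0) * hallArea 0) = 2 * hallArea (Real.pi ^ 2 / 3 * s) := by
    rw [hallArea_of_le_one zero_le_one]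
    field_simp
  rw [e] at hlim
  refine hlim.congr' ?_
  filter_upwards [eventually_gt_atTop 0] with Q hQ
  simp only [Pi.div_apply]
  rw [div_div_div_cancel_right₀ (by positivity), fareyGapFreq_eq, fareyCount_zero_one,
    fareyCount_zero_one]
  congr 2
  · congr 1
    refine Finset.filter_congr fun x hx => ?_
    rw [mul_lt_sq_iff hx hQ, fareySigma]
    have : Real.pi ^ 2 / 3 * s / Q ^ 2 = s / (3 / Real.pi ^ 2 * Q ^ 2) := by field_simp
    rw [this]
  · congr 1
    rw [Finset.filter_true_of_mem]
    intro x _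
    rw [zero_mul]
    positivity

theorem hallH_eq {s : ℝ} (hs : 0 ≤ s) : hallH s = 2 * hallArea (Real.pi ^ 2 / 3 * s) :=
  (tendsto_fareyGapFreq hs).limUnder_eq

theorem etaDensity_eq (s : ℝ) : etaDensity s = 12 / Real.pi ^ 2 * (s * hallArea (s ^ 2)) := by
  have hpi := Real.pi_pos
  rw [etaDensity, hallH_eq (by positivity)]
  have : Real.pi ^ 2 / 3 * (3 / Real.pi ^ 2 * s ^ 2) = s ^ 2 := by field_simp
  rw [this]
  ring

/-! ### The limit law -/

theorem integrableOn_ite_sq_lt {L : ℝ} (hL : 0 < L) (G : ℝ) :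
    IntegrableOn (fun t : ℝ => if t ^ 2 < G then 2 * t else 0) (Ioi L) := by
  have hcont : IntegrableOn (fun t : ℝ => 2 * t) (Ioo L √G) :=
    ((continuous_const.mul continuous_id).integrableOn_Icc).mono_set Ioo_subset_Icc_self
  have h := (integrable_indicator_iff measurableSet_Ioo).2 hcont
  refine h.integrableOn.congr_fun (s := Ioi L) (fun t ht => ?_) measurableSet_Ioi
  have ht : L < t := ht
  have : t ∈ Ioo L √G ↔ t ^ 2 < G := by
    rw [← Real.lt_sqrt (by linarith)]
    exact ⟨fun h => h.2, fun h => ⟨ht, h⟩⟩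
  by_cases hG : t ^ 2 < G
  · rw [indicator_of_mem (this.2 hG), if_pos hG]
  · rw [indicator_of_notMem (fun h => hG (this.1 h)), if_neg hG]

theorem integral_ite_sq_lt {L : ℝ} (hL : 0 < L) (G : ℝ) :
    ∫ t in Ioi L, (if t ^ 2 < G then 2 * t else 0) = max (G - L ^ 2) 0 := by
  have h1 : ∫ t in Ioi L, (if t ^ 2 < G then 2 * t else 0) =
      ∫ t in Ioi L, (Iio √G).indicator (fun t => 2 * t) t := by
    refine setIntegral_congr_fun measurableSet_Ioi fun t ht => ?_
    have ht : L < t := ht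
    have : t ∈ Iio √G ↔ t ^ 2 < G := by
      rw [← Real.lt_sqrt (by linarith)]
      rfl
    by_cases hG : t ^ 2 < G
    · rw [indicator_of_mem (this.2 hG)]
      simp only [if_pos hG]
    · rw [indicator_of_notMem (fun h => hG (this.1 h))]
      simp only [if_neg hG]
  rw [h1, setIntegral_indicator measurableSet_Iio, Ioi_inter_Iio]
  rcases le_or_gt (L ^ 2) G with h | h
  · have hLG : L ≤ √G := Real.le_sqrt_of_sq_le h
    rw [← integral_Ioc_eq_integral_Ioo, ← intervalIntegral.integral_of_le hLG,
      intervalIntegral.integral_const_mul, integral_id, Real.sq_sqrt (by nlinarith [sq_nonneg L]),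
      max_eq_left (by linarith)]
    ring
  · have hLG : √G ≤ L := by
      rw [Real.sqrt_le_left hL.le]
      exact h.le
    rw [Ioo_eq_empty (by linarith), setIntegral_empty, max_eq_right (by linarith)]

/-- The points of the gap `x` at distance at least `δ / 2` from its ends. -/
def innerGap (δ : ℝ) (x : ℕ × ℕ) : Set ℝ :=
  Icc (fareyLeft x + δ / 2) (fareyLeft x + fareyGap x - δ / 2)

theorem volume_innerGap (δ : ℝ) (x : ℕ × ℕ) :
    volume.real (innerGap δ x) = max (fareyGap x - δ) 0 := by
  rw [innerGap, Measure.real, Real.volume_Icc, ENNReal.toReal_ofReal']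
  congr 1
  ring

theorem eq_of_mem_gaps {N : ℕ} {x y : ℕ × ℕ} (hx : x ∈ fareyPairs N) (hy : y ∈ fareyPairs N) {t : ℝ}
    (hx1 : fareyLeft x ≤ t) (hx2 : t < fareyLeft x + fareyGap x)
    (hy1 : fareyLeft y ≤ t) (hy2 : t < fareyLeft y + fareyGap y) : x = y := by
  have aux : ∀ x ∈ fareyPairs N, ∀ y ∈ fareyPairs N, t < fareyLeft x + fareyGap x →
      fareyLeft y ≤ t → fareyLeft y ≤ fareyLeft x := by
    intro x hx y hy h1 h2
    by_contra hlt
    rw [not_le] at hlt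
    have hy' := mem_fareyPairs.1 hy
    refine not_mem_farey_gap hx (a := fareyNumer y.1 y.2) (b := y.1) (by exact_mod_cast hy'.1.1)
      (by exact_mod_cast hy'.1.2) ⟨?_, ?_⟩
    · push_cast
      exact hlt
    · push_cast
      exact lt_of_le_of_lt h2 h1
  exact fareyLeft_injOn hx hy (le_antisymm (aux y hy x hx hy2 hx1) (aux x hx y hy hx2 hy1))

theorem volume_iUnion_innerGap {N : ℕ} {δ : ℝ} (hδ : 0 < δ) {P : Finset (ℕ × ℕ)}
    (hP : P ⊆ fareyPairs N) :
    volume.real (⋃ x ∈ P, innerGap δ x) = ∑ x ∈ P, max (fareyGap x - δ) 0 := by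
  have hmeas : ∀ x ∈ P, MeasurableSet (innerGap δ x) := fun x _ => measurableSet_Icc
  have hfin : ∀ x ∈ P, volume (innerGap δ x) ≠ ⊤ := fun x _ => measure_Icc_lt_top.ne
  rw [measureReal_biUnion_finset ?_ hmeas hfin]
  · exact Finset.sum_congr rfl fun x _ => volume_innerGap δ x
  · intro x hx y hy hxy
    refine Set.disjoint_left.2 fun t htx hty => hxy ?_
    exact eq_of_mem_gaps (t := t) (hP hx) (hP hy) (by linarith [htx.1]) (by linarith [htx.2])
      (by linarith [hty.1]) (by linarith [hty.2])

theorem sum_ite_sq_lt_eq (a b t : ℝ) {Q : ℝ} (hQ : 0 < Q) :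
    ∑ x ∈ (fareyPairs ⌊Q⌋₊).filter fun x => a ≤ fareyLeft x ∧ fareyLeft x < b,
      (if t ^ 2 < fareyGap x * Q ^ 2 then 2 * t else 0) = fareyCount a b (t ^ 2) Q * (2 * t) := by
  rw [← Finset.sum_filter, Finset.sum_const, Finset.filter_filter, fareyCount, nsmul_eq_mul]
  congr 3
  refine Finset.filter_congr fun x hx => and_congr_right fun _ => ?_
  rw [mul_lt_sq_iff hx hQ, div_lt_iff₀ (by positivity)]

/-- The layer cake formula for the total length of the inner parts of the gaps. -/
theorem sum_max_fareyGap_sub {a b L Q : ℝ} (hL : 0 < L) (hQ : 0 < Q) :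
    ∑ x ∈ (fareyPairs ⌊Q⌋₊).filter fun x => a ≤ fareyLeft x ∧ fareyLeft x < b,
      max (fareyGap x - L ^ 2 / Q ^ 2) 0 =
    ∫ t in Ioi L, 2 * t * ((fareyCount a b (t ^ 2) Q : ℝ) / Q ^ 2) := by
  have h1 : ∀ x : ℕ × ℕ, max (fareyGap x - L ^ 2 / Q ^ 2) 0 =
      (Q ^ 2)⁻¹ * ∫ t in Ioi L, (if t ^ 2 < fareyGap x * Q ^ 2 then 2 * t else 0) := by
    intro x
    rw [integral_ite_sq_lt hL, mul_max_of_nonneg _ _ (by positivity), mul_zero]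
    congr 1
    field_simp
  simp_rw [h1]
  rw [← Finset.mul_sum, ← integral_finsetSum _ (fun x _ => integrableOn_ite_sq_lt hL _),
    ← integral_const_mul]
  refine setIntegral_congr_fun measurableSet_Ioi fun t _ => ?_
  rw [sum_ite_sq_lt_eq a b t hQ]
  ring

theorem integrableOn_two_mul_fareyCount {a b L Q : ℝ} (hL : 0 < L) (hQ : 0 < Q) :
    IntegrableOn (fun t => 2 * t * ((fareyCount a b (t ^ 2) Q : ℝ) / Q ^ 2)) (Ioi L) := by
  have h : IntegrableOn (fun t : ℝ => (Q ^ 2)⁻¹ *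
      ∑ x ∈ (fareyPairs ⌊Q⌋₊).filter fun x => a ≤ fareyLeft x ∧ fareyLeft x < b,
        if t ^ 2 < fareyGap x * Q ^ 2 then 2 * t else 0) (Ioi L) :=
    (integrable_finsetSum _ fun x _ => integrableOn_ite_sq_lt hL _).const_mul _
  refine h.congr_fun (fun t _ => ?_) measurableSet_Ioi
  simp only
  rw [sum_ite_sq_lt_eq a b t hQ]
  ring

theorem integrableOn_inv_cube {L : ℝ} (hL : 0 < L) :
    IntegrableOn (fun t : ℝ => 16 * t ^ (-3 : ℝ)) (Ioi L) :=
  (integrableOn_Ioi_rpow_of_lt (by norm_num) hL).const_mul 16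

theorem rpow_neg_three {t : ℝ} (ht : 0 < t) : t ^ (-3 : ℝ) = (t ^ 3)⁻¹ := by
  rw [Real.rpow_neg ht.le]
  norm_cast

theorem two_mul_fareyCount_le {a b t Q : ℝ} (ht : 0 < t) (hQ : 0 < Q) :
    2 * t * ((fareyCount a b (t ^ 2) Q : ℝ) / Q ^ 2) ≤ 16 * t ^ (-3 : ℝ) := by
  have h : (fareyCount a b (t ^ 2) Q : ℝ) / Q ^ 2 ≤ 8 / (t ^ 2) ^ 2 := by
    rw [div_le_iff₀ (by positivity)]
    exact fareyCount_le (by positivity) hQ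
  rw [rpow_neg_three ht]
  calc _ ≤ 2 * t * (8 / (t ^ 2) ^ 2) := by gcongr
    _ = _ := by field_simp; norm_num

theorem tendsto_two_mul_fareyCount {a b : ℝ} (ha : 0 ≤ a) (hab : a ≤ b) (hb : b ≤ 1) (t : ℝ) :
    Tendsto (fun Q : ℝ => 2 * t * ((fareyCount a b (t ^ 2) Q : ℝ) / Q ^ 2)) atTop
      (𝓝 ((b - a) * etaDensity t)) := by
  convert (tendsto_fareyCount ha hab hb (sq_nonneg t)).const_mul (2 * t) using 2
  rw [etaDensity_eq]
  ring

theorem tendsto_sum_max_fareyGap_sub {a b L : ℝ} (ha : 0 ≤ a) (hab : a ≤ b) (hb : b ≤ 1)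
    (hL : 0 < L) :
    Tendsto (fun Q : ℝ => ∑ x ∈ (fareyPairs ⌊Q⌋₊).filter fun x => a ≤ fareyLeft x ∧ fareyLeft x < b,
      max (fareyGap x - L ^ 2 / Q ^ 2) 0) atTop
      (𝓝 ((b - a) * ∫ t in Ioi L, etaDensity t)) := by
  rw [← integral_const_mul]
  have h : Tendsto (fun Q : ℝ => ∫ t in Ioi L, 2 * t * ((fareyCount a b (t ^ 2) Q : ℝ) / Q ^ 2))
      atTop (𝓝 (∫ t in Ioi L, (b - a) * etaDensity t)) := by
    refine tendsto_integral_filter_of_dominated_convergence (fun t : ℝ => 16 * t ^ (-3 : ℝ))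
      ?_ ?_ (integrableOn_inv_cube hL) ?_
    · filter_upwards [eventually_gt_atTop 0] with Q hQ
      exact (integrableOn_two_mul_fareyCount hL hQ).aestronglyMeasurable
    · filter_upwards [eventually_gt_atTop 0] with Q hQ
      refine (ae_restrict_iff' measurableSet_Ioi).2 (Eventually.of_forall fun t ht => ?_)
      have ht0 : 0 < t := hL.trans ht
      rw [Real.norm_eq_abs, abs_of_nonneg (by positivity)]
      exact two_mul_fareyCount_le ht0 hQ
    · exact Eventually.of_forall fun t => tendsto_two_mul_fareyCount ha hab hb t
  refine h.congr' ?_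
  filter_upwards [eventually_gt_atTop 0] with Q hQ
  exact (sum_max_fareyGap_sub hL hQ).symm

/-- Only the gaps at the end points of `[a, b)` distinguish the two measures. -/
theorem abs_volume_sub_sum_le {a b δ Q : ℝ} (ha : 0 ≤ a) (hb : b ≤ 1) (hδ : 0 < δ) (hQ : 1 ≤ Q) :
    |volume.real {t : ℝ | t ∈ Ico a b ∧ Q < qMin t δ} -
      ∑ x ∈ (fareyPairs ⌊Q⌋₊).filter fun x => a ≤ fareyLeft x ∧ fareyLeft x < b,
        max (fareyGap x - δ) 0| ≤ 2 / Q := by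
  have hQ0 : 0 < Q := by linarith
  set P := (fareyPairs ⌊Q⌋₊).filter fun x => a ≤ fareyLeft x ∧ fareyLeft x < b with hP
  rw [← volume_iUnion_innerGap hδ (Finset.filter_subset _ _ : P ⊆ fareyPairs ⌊Q⌋₊)]
  set S := {t : ℝ | t ∈ Ico a b ∧ Q < qMin t δ} with hS
  set U := ⋃ x ∈ P, innerGap δ x with hU
  have hSfin : volume S ≠ ⊤ :=
    ((measure_mono (fun t ht => ht.1)).trans_lt (measure_Ico_lt_top (a := a) (b := b))).ne
  have hUfin : volume U ≠ ⊤ := by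
    refine ((measure_biUnion_finset_le P _).trans_lt ?_).ne
    exact ENNReal.sum_lt_top.2 fun x _ => measure_Icc_lt_top
  have hIcc : ∀ c : ℝ, volume.real (Icc c (c + 2 / Q)) = 2 / Q := by
    intro c
    rw [Real.volume_real_Icc_of_le (by linarith [div_pos two_pos hQ0])]
    ring
  have h1 : S ⊆ U ∪ Icc a (a + 2 / Q) := by
    rintro t ⟨⟨h1, h2⟩, h3⟩
    obtain ⟨x, hx, h4, h5⟩ := exists_mem_farey_gap hQ (ha.trans h1) (h2.trans_le hb)
    rcases le_or_gt a (fareyLeft x) with h | h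
    · left
      rw [hU, mem_iUnion₂]
      exact ⟨x, Finset.mem_filter.2 ⟨hx, h, h4.trans_lt h2⟩, (lt_qMin_iff_of_mem_gap hδ hx h4 h5).1 h3⟩
    · right
      exact ⟨h1, by linarith [fareyGap_le hQ hx]⟩
  have h2 : U ⊆ S ∪ Icc b (b + 2 / Q) := by
    intro t ht
    rw [hU, mem_iUnion₂] at ht
    obtain ⟨x, hx, h3⟩ := ht
    obtain ⟨hx, h4, h5⟩ := Finset.mem_filter.1 hx
    have h6 : fareyLeft x ≤ t := by linarith [h3.1]
    have h7 : t < fareyLeft x + fareyGap x := by linarith [h3.2]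
    rcases lt_or_ge t b with h | h
    · left
      exact ⟨⟨h4.trans h6, h⟩, (lt_qMin_iff_of_mem_gap hδ hx h6 h7).2 h3⟩
    · right
      exact ⟨h, by linarith [fareyGap_le hQ hx]⟩
  have h3 := (measureReal_mono h1 (measure_union_lt_top hUfin.lt_top measure_Icc_lt_top).ne).trans
    (measureReal_union_le _ _)
  have h4 := (measureReal_mono h2 (measure_union_lt_top hSfin.lt_top measure_Icc_lt_top).ne).trans
    (measureReal_union_le _ _)
  rw [hIcc] at h3 h4
  rw [abs_le]
  constructor <;> linarith

theorem tendsto_volume_lt_qMin_atTop {a b L : ℝ} (ha : 0 ≤ a) (hab : a ≤ b) (hb : b ≤ 1)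
    (hL : 0 < L) :
    Tendsto (fun Q : ℝ => volume.real {t : ℝ | t ∈ Ico a b ∧ Q < qMin t (L ^ 2 / Q ^ 2)}) atTop
      (𝓝 ((b - a) * ∫ t in Ioi L, etaDensity t)) := by
  refine (tendsto_sum_max_fareyGap_sub ha hab hb hL).congr_dist ?_
  refine squeeze_zero' (Eventually.of_forall fun _ => dist_nonneg) ?_
    (tendsto_const_nhds.div_atTop tendsto_id : Tendsto (fun Q : ℝ => 2 / Q) atTop (𝓝 0))
  filter_upwards [eventually_ge_atTop 1] with Q hQ
  rw [dist_comm, Real.dist_eq]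
  have hQ0 : 0 < Q := by linarith
  exact abs_volume_sub_sum_le ha hb (by positivity) hQ

theorem tendsto_volume_Ico {a b L : ℝ} (ha : 0 ≤ a) (hab : a ≤ b) (hb : b ≤ 1) (hL : 0 < L) :
    Tendsto (fun δ : ℝ => volume.real {x : ℝ | x ∈ Ico a b ∧ L < δ ^ (1 / 2 : ℝ) * (qMin x δ : ℝ)})
      (𝓝[>] 0) (𝓝 ((b - a) * ∫ t in Ioi L, etaDensity t)) := by
  have hQ : Tendsto (fun δ : ℝ => L / √δ) (𝓝[>] 0) atTop := by
    refine Tendsto.const_mul_atTop hL (tendsto_inv_nhdsGT_zero.comp ?_)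
    refine tendsto_nhdsWithin_iff.2 ⟨?_, ?_⟩
    · have := Real.continuous_sqrt.tendsto 0
      rw [Real.sqrt_zero] at this
      exact this.mono_left nhdsWithin_le_nhds
    · filter_upwards [self_mem_nhdsWithin] with δ hδ
      exact Real.sqrt_pos.2 hδ
  refine ((tendsto_volume_lt_qMin_atTop ha hab hb hL).comp hQ).congr' ?_
  filter_upwards [self_mem_nhdsWithin] with δ hδ
  have hδ : 0 < δ := hδ
  have hs : 0 < √δ := Real.sqrt_pos.2 hδ
  have e : L ^ 2 / (L / √δ) ^ 2 = δ := by
    rw [div_pow, Real.sq_sqrt hδ.le]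
    field_simp
  simp only [Function.comp_apply, e]
  congr 1
  ext t
  simp only [mem_ofPred_eq]
  rw [div_lt_iff₀ hs, ← Real.sqrt_eq_rpow, mul_comm]

theorem tendsto_volume_ordConnected {D : Set ℝ} (hD : D.OrdConnected) (hD1 : D ⊆ Icc 0 1) {L : ℝ}
    (hL : 0 < L) :
    Tendsto (fun δ : ℝ => volume.real {x : ℝ | x ∈ D ∧ L < δ ^ (1 / 2 : ℝ) * (qMin x δ : ℝ)})
      (𝓝[>] 0) (𝓝 (volume.real D * ∫ t in Ioi L, etaDensity t)) := by
  rcases D.eq_empty_or_nonempty with rfl | hne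
  · simp
  have hbb : BddBelow D := ⟨0, fun x hx => (hD1 hx).1⟩
  have hba : BddAbove D := ⟨1, fun x hx => (hD1 hx).2⟩
  set a := sInf D with ha
  set b := sSup D with hb
  have hD2 : D ⊆ Icc a b := fun x hx => ⟨csInf_le hbb hx, le_csSup hba hx⟩
  have hD3 : Ioo a b ⊆ D := by
    intro x hx
    obtain ⟨y, hy, hyx⟩ := exists_lt_of_csInf_lt hne hx.1
    obtain ⟨z, hz, hxz⟩ := exists_lt_of_lt_csSup hne hx.2
    exact hD.out hy hz ⟨hyx.le, hxz.le⟩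
  have ha0 : 0 ≤ a := le_csInf hne fun x hx => (hD1 hx).1
  have hb1 : b ≤ 1 := csSup_le hne fun x hx => (hD1 hx).2
  have hab : a ≤ b := by
    obtain ⟨x, hx⟩ := hne
    exact (hD2 hx).1.trans (hD2 hx).2
  have hae : ∀ᵐ x ∂(volume : Measure ℝ), x ∈ D ↔ x ∈ Ico a b := by
    filter_upwards [Measure.ae_ne volume a, Measure.ae_ne volume b] with x hxa hxb
    constructor
    · intro hx
      exact ⟨(hD2 hx).1, lt_of_le_of_ne (hD2 hx).2 hxb⟩
    · intro hx
      exact hD3 ⟨lt_of_le_of_ne hx.1 (Ne.symm hxa), hx.2⟩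
  have hvol : volume.real D = b - a := by
    rw [measureReal_congr (Filter.eventuallyEq_set.2 hae), Real.volume_real_Ico_of_le hab]
  rw [hvol]
  refine (tendsto_volume_Ico ha0 hab hb1 hL).congr fun δ => ?_
  refine measureReal_congr (Filter.eventuallyEq_set.2 ?_)
  filter_upwards [hae] with x hx
  exact and_congr_left fun _ => hx.symm

/-! ### The total mass of the limit density -/

theorem etaDensity_nonneg {s : ℝ} (hs : 0 ≤ s) : 0 ≤ etaDensity s := by
  rw [etaDensity_eq]
  have := hallArea_nonneg (s ^ 2)
  positivity

theorem etaDensity_le {s : ℝ} (hs : 0 ≤ s) : etaDensity s ≤ s := by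
  rw [etaDensity_eq]
  have h1 : hallArea (s ^ 2) ≤ 1 / 2 := hallArea_of_le_one zero_le_one ▸ hallArea_antitone (sq_nonneg s)
  have hpi : 9 < Real.pi ^ 2 := by nlinarith [Real.pi_gt_three]
  calc 12 / Real.pi ^ 2 * (s * hallArea (s ^ 2)) ≤ 12 / 9 * (s * (1 / 2)) := by
        have := hallArea_nonneg (s ^ 2)
        gcongr
    _ ≤ s := by linarith

theorem measurable_etaDensity : Measurable etaDensity := by
  have h : etaDensity = fun s => 12 / Real.pi ^ 2 * (s * hallArea (s ^ 2)) := funext etaDensity_eq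
  rw [h]
  exact measurable_const.mul (measurable_id.mul
    (hallArea_antitone.measurable.comp (measurable_id.pow_const 2)))

theorem integrableOn_etaDensity_Ioi {L : ℝ} (hL : 0 < L) : IntegrableOn etaDensity (Ioi L) := by
  refine Integrable.mono' (integrableOn_inv_cube hL) measurable_etaDensity.aestronglyMeasurable ?_
  refine (ae_restrict_iff' measurableSet_Ioi).2 (Eventually.of_forall fun t ht => ?_)
  have ht0 : 0 < t := hL.trans ht
  rw [Real.norm_eq_abs, abs_of_nonneg (etaDensity_nonneg ht0.le)]
  have h := tendsto_two_mul_fareyCount le_rfl zero_le_one le_rfl t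
  rw [sub_zero, one_mul] at h
  refine le_of_tendsto h ?_
  filter_upwards [eventually_gt_atTop 0] with Q hQ
  exact two_mul_fareyCount_le ht0 hQ

theorem integrableOn_etaDensity_Icc (L : ℝ) : IntegrableOn etaDensity (Icc 0 L) := by
  refine Integrable.mono' (continuous_id.integrableOn_Icc) measurable_etaDensity.aestronglyMeasurable ?_
  refine (ae_restrict_iff' measurableSet_Icc).2 (Eventually.of_forall fun t ht => ?_)
  rw [Real.norm_eq_abs, abs_of_nonneg (etaDensity_nonneg ht.1)]
  exact etaDensity_le ht.1

theorem integrableOn_etaDensity : IntegrableOn etaDensity (Ici 0) := by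
  rw [← Icc_union_Ioi_eq_Ici (zero_le_one' ℝ)]
  exact (integrableOn_etaDensity_Icc 1).union (integrableOn_etaDensity_Ioi one_pos)

theorem card_fareyPairs_le (N : ℕ) : (fareyPairs N).card ≤ N * N := by
  refine (Finset.card_filter_le _ _).trans ?_
  simp

/-- The points with a fraction of denominator at most `Q` nearby are covered by `Q²` pairs of
intervals of length `δ / 2`. -/
theorem one_sub_le_volume {δ Q : ℝ} (hδ : 0 < δ) (hQ : 1 ≤ Q) :
    1 - Q ^ 2 * δ ≤ volume.real {t : ℝ | t ∈ Ico (0 : ℝ) 1 ∧ Q < qMin t δ} := by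
  set S := {t : ℝ | t ∈ Ico (0 : ℝ) 1 ∧ Q < qMin t δ} with hS
  set V : ℕ × ℕ → Set ℝ := fun x => Icc (fareyLeft x) (fareyLeft x + δ / 2) ∪
    Icc (fareyLeft x + fareyGap x - δ / 2) (fareyLeft x + fareyGap x) with hV
  have hVx : ∀ x, volume.real (V x) ≤ δ := by
    intro x
    refine (measureReal_union_le _ _).trans ?_
    rw [Real.volume_real_Icc_of_le (by linarith), Real.volume_real_Icc_of_le (by linarith)]
    linarith
  have hcov : Ico (0 : ℝ) 1 ⊆ S ∪ ⋃ x ∈ fareyPairs ⌊Q⌋₊, V x := by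
    intro t ht
    by_cases h : Q < qMin t δ
    · exact Or.inl ⟨ht, h⟩
    · right
      obtain ⟨x, hx, h1, h2⟩ := exists_mem_farey_gap hQ ht.1 ht.2
      rw [lt_qMin_iff_of_mem_gap hδ hx h1 h2, mem_Icc, not_and_or, not_le, not_le] at h
      rw [mem_iUnion₂]
      refine ⟨x, hx, ?_⟩
      rcases h with h | h
      · exact Or.inl ⟨h1, h.le⟩
      · exact Or.inr ⟨h.le, h2.le⟩
  have hSfin : volume S < ⊤ :=
    (measure_mono (fun t ht => ht.1)).trans_lt (measure_Ico_lt_top (a := (0 : ℝ)) (b := 1))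
  have hVfin : volume (⋃ x ∈ fareyPairs ⌊Q⌋₊, V x) < ⊤ := by
    refine (measure_biUnion_finset_le _ _).trans_lt ?_
    exact ENNReal.sum_lt_top.2 fun x _ => measure_union_lt_top measure_Icc_lt_top measure_Icc_lt_top
  have h1 := (measureReal_mono hcov (measure_union_lt_top hSfin hVfin).ne).trans
    (measureReal_union_le _ _)
  have h2 : volume.real (⋃ x ∈ fareyPairs ⌊Q⌋₊, V x) ≤ Q ^ 2 * δ := by
    refine (measureReal_biUnion_finset_le _ _).trans ?_
    refine (Finset.sum_le_card_nsmul _ _ _ fun x _ => hVx x).trans ?_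
    rw [nsmul_eq_mul]
    have h3 : ((fareyPairs ⌊Q⌋₊).card : ℝ) ≤ ⌊Q⌋₊ * ⌊Q⌋₊ := by
      exact_mod_cast card_fareyPairs_le ⌊Q⌋₊
    have h4 : (⌊Q⌋₊ : ℝ) ≤ Q := Nat.floor_le (by linarith)
    have : ((fareyPairs ⌊Q⌋₊).card : ℝ) ≤ Q ^ 2 := by
      rw [sq]
      exact h3.trans (by gcongr)
    gcongr
  rw [Real.volume_real_Ico_of_le zero_le_one] at h1
  linarith

theorem integral_etaDensity_Ioi_mem {L : ℝ} (hL : 0 < L) :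
    ∫ t in Ioi L, etaDensity t ∈ Icc (1 - L ^ 2) 1 := by
  have h := tendsto_volume_lt_qMin_atTop le_rfl zero_le_one le_rfl hL
  rw [sub_zero, one_mul] at h
  constructor
  · refine ge_of_tendsto h ?_
    filter_upwards [eventually_ge_atTop 1] with Q hQ
    have hQ0 : 0 < Q := by linarith
    have := one_sub_le_volume (δ := L ^ 2 / Q ^ 2) (by positivity) hQ
    rwa [mul_div_cancel₀ _ (by positivity)] at this
  · refine le_of_tendsto h (Eventually.of_forall fun Q => ?_)
    refine (measureReal_mono (s₂ := Ico (0 : ℝ) 1) (fun t ht => ht.1) measure_Ico_lt_top.ne).trans ?_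
    rw [Real.volume_real_Ico_of_le zero_le_one, sub_zero]

/-- No mass is lost as `L → 0` in the limit law. -/
theorem integral_etaDensity : ∫ s in Ici (0 : ℝ), etaDensity s = 1 := by
  have key : ∀ L : ℝ, 0 < L → |(∫ s in Ici (0 : ℝ), etaDensity s) - 1| ≤ L ^ 2 := by
    intro L hL
    have h1 : ∫ s in Ici (0 : ℝ), etaDensity s =
        (∫ s in Icc 0 L, etaDensity s) + ∫ s in Ioi L, etaDensity s := by
      rw [← Icc_union_Ioi_eq_Ici hL.le]
      refine setIntegral_union ?_ measurableSet_Ioi (integrableOn_etaDensity_Icc L)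
        (integrableOn_etaDensity_Ioi hL)
      exact Set.disjoint_left.2 fun t h h' => not_lt.2 h.2 h'
    have h2 := integral_etaDensity_Ioi_mem hL
    have h3 : 0 ≤ ∫ s in Icc 0 L, etaDensity s :=
      setIntegral_nonneg measurableSet_Icc fun s hs => etaDensity_nonneg hs.1
    have h4 : ∫ s in Icc 0 L, etaDensity s ≤ L ^ 2 := by
      have h5 : ∫ s in Icc 0 L, etaDensity s ≤ ∫ s in Icc (0 : ℝ) L, L :=
        setIntegral_mono_on (integrableOn_etaDensity_Icc L)
          (integrableOn_const measure_Icc_lt_top.ne) measurableSet_Icc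
          fun s hs => (etaDensity_le hs.1).trans hs.2
      rw [setIntegral_const, Real.volume_real_Icc_of_le hL.le, smul_eq_mul] at h5
      linarith
    rw [h1, abs_le]
    constructor <;> linarith [h2.1, h2.2]
  have hlim : Tendsto (fun L : ℝ => L ^ 2) (𝓝[>] 0) (𝓝 0) := by
    have : Tendsto (fun L : ℝ => L ^ 2) (𝓝 0) (𝓝 (0 ^ 2)) := (continuous_pow 2).tendsto 0
    rw [zero_pow two_ne_zero] at this
    exact this.mono_left nhdsWithin_le_nhds
  have h0 : |(∫ s in Ici (0 : ℝ), etaDensity s) - 1| ≤ 0 := by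
    refine ge_of_tendsto hlim ?_
    filter_upwards [self_mem_nhdsWithin] with L hL
    exact key L hL
  exact sub_eq_zero.1 (abs_nonpos_iff.1 h0)

/-! ### The explicit formula -/

/-- An antiderivative of `t - 1 + (σ t)⁻¹`. -/
noncomputable def hallPrimitive (σ t : ℝ) : ℝ := t ^ 2 / 2 - t + Real.log t / σ

theorem integral_hallPrimitive {σ c d : ℝ} (hσ : 0 < σ) (hc : 0 < c) (hcd : c ≤ d) :
    ∫ t in c..d, (t - 1 + (σ * t)⁻¹) = hallPrimitive σ d - hallPrimitive σ c := by
  have hpos : ∀ t ∈ uIcc c d, 0 < t := fun t ht => by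
    rw [uIcc_of_le hcd] at ht
    exact hc.trans_le ht.1
  refine intervalIntegral.integral_eq_sub_of_hasDerivAt (fun t ht => ?_) ?_
  · have h0 := (hpos t ht).ne'
    have h1 := (((hasDerivAt_pow 2 t).div_const 2).sub (hasDerivAt_id t)).add
      ((Real.hasDerivAt_log h0).div_const σ)
    convert h1 using 1
    · rfl
    · field_simp
      norm_num
      ring
  · refine ContinuousOn.intervalIntegrable ?_
    refine (continuousOn_id.sub continuousOn_const).add
      (ContinuousOn.inv₀ (continuousOn_const.mul continuousOn_id) fun t ht => ?_)
    exact (mul_pos hσ (hpos t ht)).ne'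

theorem integral_hallKernel_zero_inv {σ : ℝ} (hσ : 0 < σ) :
    ∫ t in (0 : ℝ)..σ⁻¹, hallKernel σ t = σ⁻¹ ^ 2 / 2 := by
  have : ∫ t in (0 : ℝ)..σ⁻¹, hallKernel σ t = ∫ t in (0 : ℝ)..σ⁻¹, t := by
    refine intervalIntegral.integral_congr fun t ht => ?_
    rw [uIcc_of_le (by positivity)] at ht
    have h : σ * t ≤ 1 := by
      calc σ * t ≤ σ * σ⁻¹ := by gcongr; exact ht.2
        _ = 1 := mul_inv_cancel₀ hσ.ne'
    simp [hallKernel, ht.1, max_eq_right h]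
  rw [this, integral_id]
  ring

theorem hallKernel_of_inv_le {σ t : ℝ} (hσ : 0 < σ) (ht : σ⁻¹ ≤ t) :
    hallKernel σ t = max 0 (t - 1 + (σ * t)⁻¹) := by
  have h : 1 ≤ σ * t := by
    calc (1 : ℝ) = σ * σ⁻¹ := (mul_inv_cancel₀ hσ.ne').symm
      _ ≤ σ * t := by gcongr
  rw [hallKernel, max_eq_left h]

theorem sub_one_add_inv_eq {σ t : ℝ} (hσ : 0 < σ) (ht : 0 < t) :
    t - 1 + (σ * t)⁻¹ = (t ^ 2 - t + σ⁻¹) / t := by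
  field_simp

theorem integral_hallKernel_of_nonneg {σ c d : ℝ} (hσ : 0 < σ) (hc : σ⁻¹ ≤ c) (hcd : c ≤ d)
    (h : ∀ t ∈ Icc c d, 0 ≤ t ^ 2 - t + σ⁻¹) :
    ∫ t in c..d, hallKernel σ t = hallPrimitive σ d - hallPrimitive σ c := by
  have hc0 : 0 < c := (inv_pos.2 hσ).trans_le hc
  rw [← integral_hallPrimitive hσ hc0 hcd]
  refine intervalIntegral.integral_congr fun t ht => ?_
  rw [uIcc_of_le hcd] at ht
  have ht0 : 0 < t := hc0.trans_le ht.1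
  rw [hallKernel_of_inv_le hσ (hc.trans ht.1), sub_one_add_inv_eq hσ ht0,
    max_eq_right (div_nonneg (h t ht) ht0.le)]

theorem integral_hallKernel_of_nonpos {σ c d : ℝ} (hσ : 0 < σ) (hc : σ⁻¹ ≤ c) (hcd : c ≤ d)
    (h : ∀ t ∈ Icc c d, t ^ 2 - t + σ⁻¹ ≤ 0) :
    ∫ t in c..d, hallKernel σ t = 0 := by
  have hc0 : 0 < c := (inv_pos.2 hσ).trans_le hc
  have : ∫ t in c..d, hallKernel σ t = ∫ t in c..d, (0 : ℝ) := by
    refine intervalIntegral.integral_congr fun t ht => ?_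
    rw [uIcc_of_le hcd] at ht
    have ht0 : 0 < t := hc0.trans_le ht.1
    rw [hallKernel_of_inv_le hσ (hc.trans ht.1), sub_one_add_inv_eq hσ ht0,
      max_eq_left (div_nonpos_of_nonpos_of_nonneg (h t ht) ht0.le)]
  rw [this, intervalIntegral.integral_zero]

theorem hallArea_of_le_four {σ : ℝ} (h1 : 1 ≤ σ) (h4 : σ ≤ 4) :
    hallArea σ = -1 / 2 + σ⁻¹ + Real.log σ / σ := by
  have hσ : 0 < σ := by linarith
  have hint := fun c d : ℝ => (continuous_hallKernel σ).intervalIntegrable (μ := volume) c d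
  have hinv : σ⁻¹ ≤ 1 := inv_le_one_of_one_le₀ h1
  rw [hallArea, ← intervalIntegral.integral_add_adjacent_intervals (hint 0 σ⁻¹) (hint σ⁻¹ 1),
    integral_hallKernel_zero_inv hσ, integral_hallKernel_of_nonneg hσ le_rfl hinv]
  · simp only [hallPrimitive, Real.log_inv, Real.log_one]
    ring
  · intro t _
    have : (1 / 4 : ℝ) ≤ σ⁻¹ := by
      rw [one_div]
      exact inv_anti₀ hσ h4
    nlinarith [sq_nonneg (t - 1 / 2)]

theorem hallArea_of_four_le {σ : ℝ} (h4 : 4 ≤ σ) :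
    hallArea σ = -1 / 2 + σ⁻¹ + √(1 / 4 - σ⁻¹) - 2 * Real.log (1 / 2 + √(1 / 4 - σ⁻¹)) / σ := by
  have hσ : 0 < σ := by linarith
  have hint := fun c d : ℝ => (continuous_hallKernel σ).intervalIntegrable (μ := volume) c d
  have hinv : σ⁻¹ ≤ 1 / 4 := by
    rw [one_div]
    exact inv_anti₀ (by norm_num) h4
  have hinv0 : 0 < σ⁻¹ := inv_pos.2 hσ
  set w := √(1 / 4 - σ⁻¹) with hw
  have hw0 : 0 ≤ w := Real.sqrt_nonneg _
  have hw2 : w ^ 2 = 1 / 4 - σ⁻¹ := Real.sq_sqrt (by linarith)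
  have hw1 : w < 1 / 2 := by nlinarith
  -- the quadratic polynomial has the roots `1 / 2 ± w`, whose product is `σ⁻¹`
  have hfac : ∀ t : ℝ, t ^ 2 - t + σ⁻¹ = (t - (1 / 2 - w)) * (t - (1 / 2 + w)) := by
    intro t
    linear_combination hw2
  have hm : σ⁻¹ ≤ 1 / 2 - w := by nlinarith
  have hprod : (1 / 2 - w) * (1 / 2 + w) = σ⁻¹ := by linear_combination -hw2
  have hlog : Real.log (1 / 2 - w) = -Real.log σ - Real.log (1 / 2 + w) := by
    have := Real.log_mul (by linarith : (1 / 2 - w) ≠ 0) (by linarith : (1 / 2 + w) ≠ 0)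
    rw [hprod, Real.log_inv] at this
    linarith
  rw [hallArea, ← intervalIntegral.integral_add_adjacent_intervals (hint 0 σ⁻¹) (hint σ⁻¹ 1),
    ← intervalIntegral.integral_add_adjacent_intervals (hint σ⁻¹ (1 / 2 - w)) (hint (1 / 2 - w) 1),
    ← intervalIntegral.integral_add_adjacent_intervals (hint (1 / 2 - w) (1 / 2 + w))
      (hint (1 / 2 + w) 1),
    integral_hallKernel_zero_inv hσ, integral_hallKernel_of_nonneg hσ le_rfl hm,
    integral_hallKernel_of_nonpos hσ hm (by linarith),
    integral_hallKernel_of_nonneg hσ (hm.trans (by linarith)) (by linarith)]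
  · simp only [hallPrimitive, Real.log_inv, Real.log_one, hlog]
    ring
  · intro t ht
    rw [hfac]
    exact mul_nonneg (by linarith [ht.1]) (by linarith [ht.1])
  · intro t ht
    rw [hfac]
    exact mul_nonpos_of_nonneg_of_nonpos (by linarith [ht.1]) (by linarith [ht.2])
  · intro t ht
    rw [hfac]
    exact mul_nonneg_of_nonpos_of_nonpos (by linarith [ht.2]) (by linarith [ht.2])

theorem proposition1p1 :
    -- the limit that defines the Hall distribution exists
    (∀ s : ℝ, 0 ≤ s → Tendsto (fun Q : ℝ => fareyGapFreq Q s) atTop (𝓝 (hallH s))) ∧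
    -- `η` is a probability density on `[0, ∞)`
    (∀ s : ℝ, 0 ≤ s → 0 ≤ etaDensity s) ∧
    IntegrableOn etaDensity (Ici 0) volume ∧
    (∫ s in Ici (0 : ℝ), etaDensity s) = 1 ∧
    -- the limit law of the smallest denominator
    (∀ D : Set ℝ, D.OrdConnected → D ⊆ Icc 0 1 → ∀ L : ℝ, 0 < L →
      Tendsto
        (fun δ : ℝ => volume.real {x : ℝ | x ∈ D ∧ L < δ ^ (1 / 2 : ℝ) * (qMin x δ : ℝ)})
        (𝓝[>] 0) (𝓝 (volume.real D * ∫ s in Ioi L, etaDensity s))) ∧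
    -- the explicit formula for `η`
    (∀ s ∈ Icc (0 : ℝ) 1, etaDensity s = 6 / Real.pi ^ 2 * s) ∧
    (∀ s ∈ Icc (1 : ℝ) 2,
      etaDensity s = 6 / Real.pi ^ 2 * (-s + 2 * s⁻¹ + 4 * s⁻¹ * Real.log s)) ∧
    (∀ s : ℝ, 2 ≤ s →
      etaDensity s = 6 / Real.pi ^ 2 *
        (-s + 2 * s⁻¹ + 2 * s * √(1 / 4 - (s ^ 2)⁻¹)
          - 4 * s⁻¹ * Real.log (1 / 2 + √(1 / 4 - (s ^ 2)⁻¹)))) := by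
  refine ⟨fun s hs => ?_, fun s hs => etaDensity_nonneg hs, integrableOn_etaDensity,
    integral_etaDensity, fun D hD hD1 L hL => tendsto_volume_ordConnected hD hD1 hL,
    fun s hs => ?_, fun s hs => ?_, fun s hs => ?_⟩
  · rw [hallH_eq hs]
    exact tendsto_fareyGapFreq hs
  · rw [etaDensity_eq, hallArea_of_le_one (pow_le_one₀ hs.1 hs.2)]
    ring
  · have hs0 : s ≠ 0 := by linarith [hs.1]
    rw [etaDensity_eq, hallArea_of_le_four (one_le_pow₀ hs.1) (by nlinarith [hs.1, hs.2]),
      Real.log_pow]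
    push_cast
    field_simp
    ring
  · have hs0 : s ≠ 0 := by linarith
    rw [etaDensity_eq, hallArea_of_four_le (by nlinarith)]
    field_simp
    ring
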